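/- Let $p$ be a prime and $\Gamma$ be $\Gamma_0(p)$ or $\Gamma_1=\mathrm{SL}_2(\mathbb Z)$. For a cusp $\mathfrak a$ of $\Gamma$ with stabilizer $\Gamma_{\mathfrak a}$ let $\tau_{\mathfrak a}\in \mathrm{SL}_2(\mathbb R)$ be a scaling matrix, i.e. $\tau_{\mathfrak a}\infty=\mathfrak a$ and $\tau_{\mathfrak a}^{-1}\Gamma\tau_{\mathfrak a}\cap N=\{\left(\begin{smallmatrix}1&k\\0&1\end{smallmatrix}\right):k\in\mathbb Z\}$, where $N$ is the group of real upper triangular unipotent matrices. We take $\tau_\infty=I$, and for the cusp $0$ of $\Gamma_0(p)$ we take $\tau_0=\left(\begin{smallmatrix}0&1/\sqrt p\\-\sqrt p&0\end{smallmatrix}\right)$. Let $E_{\Gamma,\mathfrak a}(z,s)$ be the Eisenstein series $\sum_{\gamma\in\Gamma_{\mathfrak a}\backslash\Gamma}\mathrm{Im}(\tau_{\mathfrak a}^{-1}\gamma z)^s$ for $\mathrm{Re}(s)>1$, continued meromorphically to $s\in\mathbb C$. For an integer $m\ne0$, let $\phi_{\mathfrak a,\mathfrak b}(s;m)$ be the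 number for which, for all $y>0$, $$\int_0^1E_{\Gamma,\mathfrak b}(\tau_{\mathfrak a}(x+iy),s)\,e^{-2\pi imx}\,dx=\phi_{\mathfrak a,\mathfrak b}(s;m)\,2\sqrt y\,K_{s-\frac12}(2\pi|m|y),$$ where $K_\nu$ is the modified Bessel function of the second kind. Write $\phi(s;m)$ for $\phi_{\infty,\infty}(s;m)$ when $\Gamma=\Gamma_1$, and $\phi_{\mathfrak a,\mathfrak b}(s;m)$, $\mathfrak a,\mathfrak b\in\{\infty,0\}$, for the coefficients when $\Gamma=\Gamma_0(p)$. Put $\zeta^*(s)=\pi^{-s/2}\Gamma(s/2)\zeta(s)$. Then for every integer $m\neq0$ and every $s\in\mathbb C$ with $s\ne1$, $p^{2s}\neq1$ and $\zeta^*(2s)\ne0$, all these coefficients exist, $$\phi(s;m)=\frac{1}{\zeta^*(2s)}\sum_{ab=|m|}\left(\frac ab\right)^{s-\frac12}$$ (the sum being over positive integers $a,b$, and the right-hand side being read as $0$ at $s=\frac12$, where $\zeta^*(2s)$ has a pole), and $$\phi_{\infty,\infty}(s;m)=\phi_{0,0}(s;m)=\frac{1}{p^{2s}-1}\begin{cases}-\phi(s;m)&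 p\nmid m,\\ p^{s+1/2}\phi(s;\tfrac mp)-\phi(s;m)& p\mid m,\end{cases}$$ $$\phi_{\infty,0}(s;m)=\phi_{0,\infty}(s;m)=\frac{1}{p^{2s}-1}\begin{cases}p^s\phi(s;m)& p\nmid m,\\ p^s\phi(s;m)-\sqrt p\,\phi(s;\tfrac mp)& p\mid m.\end{cases}$$ -/

import Mathlib

open Matrix SpecialLinearGroup UpperHalfPlane MeasureTheory
open scoped MatrixGroups

noncomputable section

namespace EisFourier

/-- The inclusion of `SL(2, ℤ)` in `SL(2, ℝ)`. -/
def toReal : SL(2, ℤ) →* SL(2, ℝ) := SpecialLinearGroup.map (Int.castRingHom ℝ)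

/-- The unipotent matrix `n_x` with rows `(1, x)` and `(0, 1)`. -/
def unip (x : ℝ) : SL(2, ℝ) := ⟨!![1, x; 0, 1], by simp [Matrix.det_fin_two]⟩

/-- The matrix with rows `(1, 0)` and `(x, 1)`. -/
def lowUnip (x : ℝ) : SL(2, ℝ) := ⟨!![1, 0; x, 1], by simp [Matrix.det_fin_two]⟩

theorem toReal_apply (g : SL(2, ℤ)) (i j : Fin 2) : toReal g i j = (g i j : ℝ) := rfl

theorem mul_entry (g h : SL(2, ℝ)) (i j : Fin 2) :
    (g * h) i j = g i 0 * h 0 j + g i 1 * h 1 j := by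
  change ((g : Matrix (Fin 2) (Fin 2) ℝ) * (h : Matrix (Fin 2) (Fin 2) ℝ)) i j = _
  rw [Matrix.mul_apply, Fin.sum_univ_two]

theorem sl_ext {g h : SL(2, ℝ)} (h00 : g 0 0 = h 0 0) (h01 : g 0 1 = h 0 1)
    (h10 : g 1 0 = h 1 0) (h11 : g 1 1 = h 1 1) : g = h := by
  apply Matrix.SpecialLinearGroup.ext
  intro i j
  fin_cases i <;> fin_cases j
  exacts [h00, h01, h10, h11]

theorem toReal_unip (k : ℤ) :
    toReal ⟨!![1, k; 0, 1], by simp [Matrix.det_fin_two]⟩ = unip k := by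
  apply sl_ext
  exacts [Int.cast_one, rfl, Int.cast_zero, Int.cast_one]

theorem toReal_lowUnip (k : ℤ) :
    toReal ⟨!![1, 0; k, 1], by simp [Matrix.det_fin_two]⟩ = lowUnip k := by
  apply sl_ext
  exacts [Int.cast_one, Int.cast_zero, rfl, Int.cast_one]

/-- A cusp `𝔞` of `Γ` together with a scaling matrix `τ_𝔞`, that is `τ_𝔞 ∞ = 𝔞` and
`τ_𝔞⁻¹ Γ τ_𝔞 ∩ N = {n_k : k ∈ ℤ}`. -/
structure ScaledCusp (Γ : Subgroup SL(2, ℤ)) where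
  /-- the cusp -/
  point : OnePoint ℝ
  /-- the scaling matrix -/
  scaling : SL(2, ℝ)
  scaling_infty : (scaling : GL (Fin 2) ℝ) • (OnePoint.infty : OnePoint ℝ) = point
  width_one : ∀ x : ℝ,
    scaling * unip x * scaling⁻¹ ∈ Γ.map toReal ↔ ∃ k : ℤ, x = (k : ℝ)

variable {Γ : Subgroup SL(2, ℤ)}

/-- The stabilizer `Γ_𝔞` of the cusp in `Γ`. -/
def ScaledCusp.stab (𝔞 : ScaledCusp Γ) : Subgroup Γ :=
  (MulAction.stabilizer (GL (Fin 2) ℝ) 𝔞.point).comap ((mapGL ℝ).comp Γ.subtype)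

/-- The set `Γ_𝔞 \ Γ` of cosets `Γ_𝔞 γ`. -/
abbrev ScaledCusp.Cosets (𝔞 : ScaledCusp Γ) : Type :=
  Quotient (QuotientGroup.rightRel 𝔞.stab)

theorem unip_conj (g : SL(2, ℝ)) (hg : g 1 0 = 0) : g * unip 1 * g⁻¹ = unip ((g 0 0) ^ 2) := by
  have hdet := g.det_coe
  rw [Matrix.det_fin_two, hg, mul_zero, sub_zero] at hdet
  rw [mul_inv_eq_iff_eq_mul]
  apply sl_ext <;> rw [mul_entry, mul_entry] <;> simp [unip, hg]
  linear_combination (-(g 0 0)) * hdet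

theorem ScaledCusp.sq_int (𝔞 : ScaledCusp Γ) (h : SL(2, ℤ)) (hΓ : h ∈ Γ)
    (hg : (𝔞.scaling⁻¹ * toReal h * 𝔞.scaling) 1 0 = 0) :
    ∃ k : ℤ, ((𝔞.scaling⁻¹ * toReal h * 𝔞.scaling) 0 0) ^ 2 = (k : ℝ) := by
  rw [← 𝔞.width_one, ← unip_conj _ hg]
  have h1 : 𝔞.scaling * unip 1 * 𝔞.scaling⁻¹ ∈ Γ.map toReal :=
    (𝔞.width_one 1).2 ⟨1, by simp⟩
  have h2 : toReal h ∈ Γ.map toReal := ⟨h, hΓ, rfl⟩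
  have h3 := mul_mem (mul_mem h2 h1) (inv_mem h2)
  convert h3 using 1
  group

theorem ScaledCusp.im_eq_of_stab (𝔞 : ScaledCusp Γ) (h : Γ) (hh : h ∈ 𝔞.stab) (z : ℍ) :
    (𝔞.scaling⁻¹ • (h : SL(2, ℤ)) • z).im = (𝔞.scaling⁻¹ • z).im := by
  set τ := 𝔞.scaling with hτ
  have hfix : ∀ k : Γ, k ∈ 𝔞.stab → (τ⁻¹ * toReal (k : SL(2, ℤ)) * τ) 1 0 = 0 := by
    intro k hk
    have hk' : (mapGL ℝ (k : SL(2, ℤ))) • 𝔞.point = 𝔞.point := hk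
    have h1 : ((τ⁻¹ * toReal (k : SL(2, ℤ)) * τ : SL(2, ℝ)) : GL (Fin 2) ℝ) •
        (OnePoint.infty : OnePoint ℝ) = OnePoint.infty := by
      rw [map_mul, map_mul, mul_smul, mul_smul, hτ, 𝔞.scaling_infty]
      have : ((toReal (k : SL(2, ℤ)) : SL(2, ℝ)) : GL (Fin 2) ℝ) = mapGL ℝ (k : SL(2, ℤ)) := rfl
      rw [this, hk', map_inv, inv_smul_eq_iff, 𝔞.scaling_infty]
    exact OnePoint.smul_infty_eq_self_iff.mp h1
  set g := τ⁻¹ * toReal (h : SL(2, ℤ)) * τ with hgdef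
  have hg := hfix h hh
  obtain ⟨k, hk⟩ := 𝔞.sq_int h h.2 hg
  have hinv := hfix h⁻¹ (inv_mem hh)
  have hginv : τ⁻¹ * toReal ((h⁻¹ : Γ) : SL(2, ℤ)) * τ = g⁻¹ := by
    rw [hgdef]; simp only [Subgroup.coe_inv, map_inv]; group
  obtain ⟨l, hl⟩ := 𝔞.sq_int _ (h⁻¹ : Γ).2 hinv
  rw [← hτ, hginv] at hl
  rw [← hτ, ← hgdef] at hk
  have hl' : (g 1 1) ^ 2 = (l : ℝ) := by
    rw [← hl]; simp [Matrix.SpecialLinearGroup.coe_inv, Matrix.adjugate_fin_two]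
  have hdet := g.det_coe
  rw [Matrix.det_fin_two, hg, mul_zero, sub_zero] at hdet
  have hkl : k * l = 1 := by
    have : (k : ℝ) * l = 1 := by rw [← hk, ← hl', ← mul_pow, hdet, one_pow]
    exact_mod_cast this
  have hl0 : 0 ≤ l := by
    have : (0 : ℝ) ≤ l := by rw [← hl']; positivity
    exact_mod_cast this
  have hl1 : l = 1 := by
    rcases Int.isUnit_iff.mp (IsUnit.of_mul_eq_one k (by rw [mul_comm]; exact hkl)) with h1 | h1
    · exact h1
    · omega
  have hact : τ⁻¹ • (h : SL(2, ℤ)) • z = g • τ⁻¹ • z := by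
    have h1 : (h : SL(2, ℤ)) • z = toReal (h : SL(2, ℤ)) • z := rfl
    rw [h1, smul_smul, smul_smul, hgdef, mul_inv_cancel_right]
  rw [hact]
  generalize τ⁻¹ • z = w
  have h3 : (g • w).im = w.im / Complex.normSq (denom (g : GL (Fin 2) ℝ) w) := by
    have := UpperHalfPlane.im_smul_eq_div_normSq (g : GL (Fin 2) ℝ) w
    have hd : |((g : GL (Fin 2) ℝ)).det.val| = 1 := by simp
    rw [hd, one_mul] at this
    exact this
  have h4 : denom (g : GL (Fin 2) ℝ) w = (g 1 1 : ℂ) := by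
    have : denom (g : GL (Fin 2) ℝ) w = (g 1 0 : ℂ) * w + (g 1 1 : ℂ) := rfl
    rw [this, hg]; simp
  rw [h3, h4, Complex.normSq_ofReal, ← sq, hl', hl1]
  simp

/-- `Im (τ_𝔞⁻¹ γ z)` as a function of the coset `Γ_𝔞 γ`. -/
def ScaledCusp.imAt (𝔞 : ScaledCusp Γ) (z : ℍ) : 𝔞.Cosets → ℝ :=
  Quotient.lift (fun γ : Γ => (𝔞.scaling⁻¹ • (γ : SL(2, ℤ)) • z).im) (by
    intro a b hab
    have h1 : b * a⁻¹ ∈ 𝔞.stab := QuotientGroup.rightRel_apply.mp hab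
    have h2 := 𝔞.im_eq_of_stab _ h1 ((a : SL(2, ℤ)) • z)
    rw [smul_smul (_ : SL(2, ℤ))] at h2
    simpa using h2.symm)

/-- The series `∑_{γ ∈ Γ_𝔞 \ Γ} Im(τ_𝔞⁻¹ γ z)^s`, which converges for `Re s > 1`. -/
def eisensteinSeries (𝔞 : ScaledCusp Γ) (z : ℍ) (s : ℂ) : ℂ :=
  ∑' q : 𝔞.Cosets, (𝔞.imAt z q : ℂ) ^ s

open Classical in
/-- The meromorphic continuation to `ℂ` of a function given on `Re s > 1`, normalized so that
it is analytic at removable singularities and `0` at poles (it is unique when it exists;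
the function is returned unchanged if there is none). -/
def meroCont (f : ℂ → ℂ) : ℂ → ℂ :=
  if h : ∃ g : ℂ → ℂ, MeromorphicNFOn g Set.univ ∧ ∀ s : ℂ, 1 < s.re → g s = f s
  then h.choose else f

/-- The Eisenstein series `E_{Γ,𝔞}(z, s)`, meromorphically continued in `s`. -/
def eisenstein (𝔞 : ScaledCusp Γ) (z : ℍ) (s : ℂ) : ℂ :=
  meroCont (eisensteinSeries 𝔞 z) s

/-- The modified Bessel function of the second kind,
`K_ν(y) = (1/2) ∫_0^∞ t^{ν-1} exp(-y (t + 1/t) / 2) dt` for `y > 0`. -/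
def besselK (ν : ℂ) (y : ℝ) : ℂ :=
  (1 / 2) * ∫ t : ℝ in Set.Ioi 0, (t : ℂ) ^ (ν - 1) * (Real.exp (-(y * (t + 1 / t) / 2)) : ℂ)

/-- `E_{Γ,𝔟}(τ_𝔞 (x + iy), s) e(-mx)`, where `e(x) = exp(2πix)`. -/
def fourierIntegrand (𝔞 𝔟 : ScaledCusp Γ) (s : ℂ) (m : ℤ) (y : ℝ) (hy : 0 < y) (x : ℝ) : ℂ :=
  eisenstein 𝔟 (𝔞.scaling • (⟨⟨x, y⟩, hy⟩ : ℍ)) s *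
    Complex.exp (-(2 * Real.pi * Complex.I * m * x))

/-- `c` is the number `φ_{𝔞,𝔟}(s;m)`: for every `y > 0` the `m`-th Fourier coefficient
`a_{𝔞,𝔟}(s;m,y)` of `x ↦ E_{Γ,𝔟}(τ_𝔞 (x + iy), s)` is `c · 2 √y K_{s-1/2}(2π|m|y)`. -/
def IsEisCoeff (𝔞 𝔟 : ScaledCusp Γ) (s : ℂ) (m : ℤ) (c : ℂ) : Prop :=
  ∀ (y : ℝ) (hy : 0 < y),
    IntervalIntegrable (fourierIntegrand 𝔞 𝔟 s m y hy) volume 0 1 ∧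
    ∫ x in (0 : ℝ)..1, fourierIntegrand 𝔞 𝔟 s m y hy x =
      c * (2 * (Real.sqrt y : ℂ) * besselK (s - 1 / 2) (2 * Real.pi * |(m : ℝ)| * y))

open Classical in
/-- The coefficient `φ_{𝔞,𝔟}(s;m)` of the Eisenstein series `E_{Γ,𝔟}` at the cusp `𝔞`
(`0` if there is no such number). -/
def eisCoeff (𝔞 𝔟 : ScaledCusp Γ) (s : ℂ) (m : ℤ) : ℂ :=
  if h : ∃ c : ℂ, IsEisCoeff 𝔞 𝔟 s m c then h.choose else 0

/-- The divisor function `τ_s(m) = ∑_{ab=|m|} (a/b)^s`. -/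
def divisorTau (s : ℂ) (m : ℤ) : ℂ :=
  ∑ d ∈ m.natAbs.divisorsAntidiagonal, ((d.1 : ℂ) / (d.2 : ℂ)) ^ s

/-- The cusp `∞` of `SL(2, ℤ)`, with scaling matrix `1`. -/
def cuspFull : ScaledCusp (⊤ : Subgroup SL(2, ℤ)) where
  point := OnePoint.infty
  scaling := 1
  scaling_infty := by simp
  width_one := by
    intro x
    rw [one_mul, inv_one, mul_one]
    constructor
    · rintro ⟨g, -, hg⟩
      refine ⟨g 0 1, ?_⟩
      have := congrArg (fun M : SL(2, ℝ) => M 0 1) hg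
      simpa [unip, toReal] using this.symm
    · rintro ⟨k, rfl⟩
      refine ⟨⟨!![1, k; 0, 1], by simp [Matrix.det_fin_two]⟩, ?_, ?_⟩
      · exact Subgroup.mem_top _
      · exact toReal_unip k

/-- The cusp `∞` of `Γ₀(p)`, with scaling matrix `1`. -/
def cuspInfty (p : ℕ) : ScaledCusp (CongruenceSubgroup.Gamma0 p) where
  point := OnePoint.infty
  scaling := 1
  scaling_infty := by simp
  width_one := by
    intro x
    rw [one_mul, inv_one, mul_one]
    constructor
    · rintro ⟨g, -, hg⟩
      refine ⟨g 0 1, ?_⟩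
      have := congrArg (fun M : SL(2, ℝ) => M 0 1) hg
      simpa [unip, toReal] using this.symm
    · rintro ⟨k, rfl⟩
      refine ⟨⟨!![1, k; 0, 1], by simp [Matrix.det_fin_two]⟩, ?_, ?_⟩
      · exact CongruenceSubgroup.Gamma0_mem.mpr (by simp)
      · exact toReal_unip k

/-- The matrix `τ_0` with rows `(0, 1/√p)` and `(-√p, 0)`. -/
def tauZero (p : ℕ) (hp : 0 < p) : SL(2, ℝ) :=
  ⟨!![0, 1 / Real.sqrt p; -Real.sqrt p, 0], by
    have : Real.sqrt p ≠ 0 := by positivity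
    simp [Matrix.det_fin_two, this]⟩

/-- The cusp `0` of `Γ₀(p)`, with scaling matrix `τ_0`. -/
def cuspZero (p : ℕ) (hp : 0 < p) : ScaledCusp (CongruenceSubgroup.Gamma0 p) where
  point := ((0 : ℝ) : OnePoint ℝ)
  scaling := tauZero p hp
  scaling_infty := by
    have : Real.sqrt p ≠ 0 := by positivity
    have h10 : ((tauZero p hp : SL(2, ℝ)) : GL (Fin 2) ℝ) 1 0 = -Real.sqrt p := rfl
    have h00 : ((tauZero p hp : SL(2, ℝ)) : GL (Fin 2) ℝ) 0 0 = 0 := rfl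
    rw [OnePoint.smul_infty_eq_ite, h10, h00]
    simp [this]
  width_one := by
    intro x
    have hp0 : (0 : ℝ) < p := by exact_mod_cast hp
    have hs : Real.sqrt p ≠ 0 := by positivity
    have hconj : tauZero p hp * unip x * (tauZero p hp)⁻¹ =
        lowUnip (-(p * x)) := by
      rw [mul_inv_eq_iff_eq_mul]
      have := Real.mul_self_sqrt hp0.le
      apply sl_ext <;> rw [mul_entry, mul_entry] <;> simp [unip, tauZero, lowUnip]
      field_simp
      linear_combination x * this
    rw [hconj]
    constructor
    · rintro ⟨g, hg, hgx⟩
      have hg' : ((g 1 0 : ℤ) : ZMod p) = 0 := CongruenceSubgroup.Gamma0_mem.mp hg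
      obtain ⟨k, hk⟩ := (ZMod.intCast_zmod_eq_zero_iff_dvd _ _).mp hg'
      have h1 := congrArg (fun M : SL(2, ℝ) => M 1 0) hgx
      have h2 : ((g 1 0 : ℤ) : ℝ) = -(p * x) := by rw [← toReal_apply]; exact h1
      refine ⟨-k, ?_⟩
      rw [hk] at h2
      push_cast at h2 ⊢
      have h3 : (p : ℝ) * (x + k) = 0 := by linear_combination h2
      rcases mul_eq_zero.mp h3 with h4 | h4
      · exact absurd h4 hp0.ne'
      · linarith
    · rintro ⟨k, rfl⟩
      refine ⟨⟨!![1, 0; -(p * k), 1], by simp [Matrix.det_fin_two]⟩, ?_, ?_⟩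
      · apply CongruenceSubgroup.Gamma0_mem.mpr
        simp
      · rw [toReal_lowUnip]; push_cast; rfl

end EisFourier

end

/-! Everything reduces to the lattice sum `L(z,s) = ∑ (y/|cz+d|²)^s` over all integer pairs.
Extracting the gcd of `(c,d)` gives `L = 2 ζ(2s) E` at level one. At level `p` the cosets at the
cusp `∞` are, up to sign, the primitive pairs whose first entry is divisible by `p`, and those at
the cusp `0` are the remaining primitive pairs. Since `L(pz,s)` is `p^s` times the part of `L(z,s)`
with `p ∣ c`, the values `L(z,s)` and `L(pz,s)` are two independent combinations of these two
primitive sums. Solving for them (`level_eisensteinSeries`) gives `(p^{2s} - 1) E_∞(z) = p^s E(pz) -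
E(z)` and `(p^{2s} - 1) E_0(z) = p^s E(z) - E(pz)`. As `τ_0 z = -1/(pz)` and `L` is invariant under
`z ↦ -1/z`, passing to the cusp `0` exchanges the two right-hand sides (`latticeSum_tauZero`); this
is why only two different coefficients occur among the four.

The expansion of `L` comes from Poisson summation over `d` in each row `c ≠ 0`, by way of the
functional equation of a theta function (`poisson_row`, `latticeSum_fourier`). Its Bessel part
converges for every `s`, so once the poles of `ζ^*` are cleared by `xiFun` the expansion itself is
the continuation `eisExt`; the identity theorem (`meroCont_eq`) identifies it with the function
selected by `meroCont`. Termwise integration collects the frequencies `ab = |m|` into the divisor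
sum. The function `E(pz)` has only frequencies divisible by `p`, and `√(py) = √p √y` supplies the
factor `√p` in front of `φ(s;m/p)`. Finally, `K_ν` is not identically zero on `y > 0`
(`exists_besselK_ne_zero`), so the coefficient is unique. -/

namespace EisFourier

/-! ### Uniqueness of the meromorphic continuation -/

/-- The normal form of `F` shows that a continuation exists; by the identity theorem on the
connected plane, whichever one was chosen agrees with `F` off a discrete set. -/
theorem meroCont_eq {f F : ℂ → ℂ} (hF : MeromorphicOn F Set.univ)
    (hFa : ∀ s : ℂ, 1 < s.re → AnalyticAt ℂ F s) (hFf : ∀ s : ℂ, 1 < s.re → F s = f s)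
    {s : ℂ} (hs : AnalyticAt ℂ F s) : meroCont f s = F s := by
  have hex : ∃ g : ℂ → ℂ, MeromorphicNFOn g Set.univ ∧ ∀ s : ℂ, 1 < s.re → g s = f s := by
    refine ⟨toMeromorphicNFOn F Set.univ, meromorphicNFOn_toMeromorphicNFOn F Set.univ, ?_⟩
    intro w hw
    rw [toMeromorphicNFOn_eq_toMeromorphicNFAt hF (Set.mem_univ w),
      toMeromorphicNFAt_eq_self.2 (hFa w hw).meromorphicNFAt, hFf w hw]
  have hg : meroCont f = hex.choose := by
    rw [meroCont, dif_pos hex]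
  obtain ⟨hg1, hg2⟩ := hex.choose_spec
  rw [hg]
  generalize hex.choose = g at hg1 hg2
  have hsub : MeromorphicOn (g - F) Set.univ := hg1.meromorphicOn.sub hF
  -- Infinite order propagates from the point `2`, near which both functions equal `f`, to the whole
  -- plane.
  have hzero : ∀ w : ℂ, meromorphicOrderAt (g - F) w = ⊤ := by
    intro w
    by_contra hne
    have h2 : meromorphicOrderAt (g - F) 2 ≠ ⊤ :=
      hsub.meromorphicOrderAt_ne_top_of_isPreconnected isPreconnected_univ
        (Set.mem_univ w) (Set.mem_univ 2) hne
    apply h2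
    rw [meromorphicOrderAt_eq_top_iff]
    apply Filter.Eventually.filter_mono nhdsWithin_le_nhds
    have : {w : ℂ | 1 < w.re} ∈ nhds (2 : ℂ) :=
      (isOpen_lt continuous_const Complex.continuous_re).mem_nhds (by simp)
    filter_upwards [this] with w hw
    simp [hg2 w hw, hFf w hw]
  have h1 : g =ᶠ[nhdsWithin s {s}ᶜ] F := by
    have := meromorphicOrderAt_eq_top_iff.1 (hzero s)
    filter_upwards [this] with w hw
    exact sub_eq_zero.1 hw
  -- Both functions are in normal form at `s`, so agreement on a punctured neighbourhood forces
  -- agreement at `s` itself.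
  exact (((hg1 (Set.mem_univ s)).eventuallyEq_nhdsNE_iff_eventuallyEq_nhds
    hs.meromorphicNFAt).1 h1).eq_of_nhds

/-! ### The modified Bessel function of the second kind -/

/-- The exponential factor in the integral defining `besselK`. -/
noncomputable def besselKernel (y t : ℝ) : ℝ := Real.exp (-(y * (t + 1 / t) / 2))

theorem besselK_eq_mellin (ν : ℂ) (y : ℝ) :
    besselK ν y = (1 / 2) * mellin (fun t => (besselKernel y t : ℂ)) ν := by
  simp [besselK, mellin, besselKernel]

theorem continuousOn_besselKernel (y : ℝ) : ContinuousOn (besselKernel y) (Set.Ioi 0) := by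
  unfold besselKernel
  have : ∀ t ∈ Set.Ioi (0:ℝ), t ≠ 0 := fun t ht => (ne_of_gt ht)
  fun_prop (disch := assumption)

theorem locallyIntegrableOn_besselKernel (y : ℝ) :
    LocallyIntegrableOn (fun t => (besselKernel y t : ℂ)) (Set.Ioi 0) :=
  ContinuousOn.locallyIntegrableOn
    (Complex.continuous_ofReal.comp_continuousOn (continuousOn_besselKernel y)) measurableSet_Ioi

theorem besselKernel_isBigO_top {y : ℝ} (hy : 0 < y) :
    (fun t => (besselKernel y t : ℂ)) =O[Filter.atTop] fun t => Real.exp (-(y / 2) * t) := by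
  apply Asymptotics.IsBigO.of_bound 1
  filter_upwards [Filter.eventually_gt_atTop 0] with t ht
  rw [besselKernel, Complex.norm_real, Real.norm_of_nonneg (Real.exp_nonneg _),
    Real.norm_of_nonneg (Real.exp_nonneg _), one_mul]
  apply Real.exp_le_exp.2
  have : 0 < y * (1 / t) := by positivity
  nlinarith

theorem besselKernel_isBigO_zero {y : ℝ} (hy : 0 < y) (b : ℝ) :
    (fun t => (besselKernel y t : ℂ)) =O[nhdsWithin 0 (Set.Ioi 0)] fun t => t ^ (-b) := by
  have h1 := (isLittleO_exp_neg_mul_rpow_atTop (half_pos hy) b).isBigO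
  have h2 := h1.comp_tendsto tendsto_inv_nhdsGT_zero
  refine Asymptotics.IsBigO.trans (Asymptotics.IsBigO.of_bound 1 ?_) (h2.congr' (Filter.EventuallyEq.refl _ _) ?_)
  · filter_upwards [self_mem_nhdsWithin] with t ht
    have ht : 0 < t := ht
    rw [besselKernel, Complex.norm_real, Real.norm_of_nonneg (Real.exp_nonneg _), Function.comp,
      Real.norm_of_nonneg (Real.exp_nonneg _), one_mul]
    apply Real.exp_le_exp.2
    have : 0 < y * t := by positivity
    rw [one_div]
    nlinarith
  · filter_upwards [self_mem_nhdsWithin] with t ht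
    have ht : 0 < t := ht
    simp only [Function.comp]
    rw [Real.inv_rpow ht.le, Real.rpow_neg ht.le]

/-- The kernel decays exponentially at infinity and, because of the term `1/t`, faster than every
power at `0`. Hence no condition on `ν` is needed, and `besselK` is entire in `ν`. -/
theorem mellinConvergent_besselKernel {y : ℝ} (hy : 0 < y) (ν : ℂ) :
    MellinConvergent (fun t => (besselKernel y t : ℂ)) ν :=
  mellinConvergent_of_isBigO_rpow_exp (half_pos hy) (locallyIntegrableOn_besselKernel y)
    (besselKernel_isBigO_top hy) (besselKernel_isBigO_zero hy (ν.re - 1)) (by linarith)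

theorem differentiable_besselK {y : ℝ} (hy : 0 < y) : Differentiable ℂ fun ν => besselK ν y := by
  intro ν
  simp_rw [besselK_eq_mellin]
  exact (mellin_differentiableAt_of_isBigO_rpow_exp (half_pos hy)
    (locallyIntegrableOn_besselKernel y)
    (besselKernel_isBigO_top hy) (besselKernel_isBigO_zero hy (ν.re - 1)) (by linarith)).const_mul _

theorem integrableOn_rpow_mul_besselKernel {y : ℝ} (hy : 0 < y) (a : ℝ) :
    IntegrableOn (fun t => t ^ (a - 1) * besselKernel y t) (Set.Ioi 0) := by
  have h := (mellinConvergent_besselKernel hy (a : ℂ))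
  have h : IntegrableOn (fun t : ℝ => ‖(t : ℂ) ^ ((a : ℂ) - 1) • (besselKernel y t : ℂ)‖)
      (Set.Ioi 0) := Integrable.norm h
  refine h.congr_fun (fun t ht => ?_) measurableSet_Ioi
  have ht : 0 < t := ht
  simp only [norm_smul, Complex.norm_cpow_eq_rpow_re_of_pos ht, Complex.norm_real]
  rw [besselKernel, Real.norm_of_nonneg (Real.exp_nonneg _)]
  simp

theorem two_le_add_one_div {t : ℝ} (ht : 0 < t) : 2 ≤ t + 1 / t := by
  have : t + 1 / t - 2 = (t - 1) ^ 2 / t := by field_simp; ring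
  have : 0 ≤ (t - 1) ^ 2 / t := by positivity
  linarith

/-- Because `t + 1/t ≥ 2` and `y - y₀/2 ≥ y/2`, a factor `exp(-y/2)` splits off and leaves the fixed
kernel with parameter `y₀/2`. On the strip, `t^(Re ν - 1)` is at most the sum of the two extreme
powers. -/
theorem exists_norm_besselK_le (A : ℝ) {y₀ : ℝ} (hy₀ : 0 < y₀) :
    ∃ C : ℝ, 0 ≤ C ∧ ∀ (ν : ℂ) (y : ℝ), |ν.re| ≤ A → y₀ ≤ y →
      ‖besselK ν y‖ ≤ C * Real.exp (-(y / 2)) := by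
  have hI : IntegrableOn (fun t => t ^ (A - 1) * besselKernel (y₀ / 2) t +
      t ^ (-A - 1) * besselKernel (y₀ / 2) t) (Set.Ioi 0) :=
    (integrableOn_rpow_mul_besselKernel (half_pos hy₀) A).add
    (integrableOn_rpow_mul_besselKernel (half_pos hy₀) (-A))
  refine ⟨(1 / 2) * ∫ t in Set.Ioi 0, (t ^ (A - 1) * besselKernel (y₀ / 2) t +
      t ^ (-A - 1) * besselKernel (y₀ / 2) t), ?_, ?_⟩
  · refine mul_nonneg (by norm_num) (setIntegral_nonneg measurableSet_Ioi fun t ht => ?_)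
    have ht : 0 < t := ht
    unfold besselKernel
    positivity
  intro ν y hν hy
  rw [besselK_eq_mellin, norm_mul, mellin]
  have h2 : ‖(1 / 2 : ℂ)‖ = 1 / 2 := by norm_num
  rw [h2, mul_assoc]
  apply mul_le_mul_of_nonneg_left _ (by norm_num)
  rw [← integral_mul_const]
  apply norm_integral_le_of_norm_le (hI.mul_const _)
  rw [ae_restrict_iff' measurableSet_Ioi]
  refine Filter.Eventually.of_forall fun t ht => ?_
  have ht : 0 < t := ht
  rw [norm_smul, Complex.norm_cpow_eq_rpow_re_of_pos ht, Complex.norm_real, ← add_mul, mul_assoc]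
  have hA := abs_le.1 hν
  have hpow : t ^ ((ν - 1).re) ≤ t ^ (A - 1) + t ^ (-A - 1) := by
    have e : (ν - 1).re = ν.re - 1 := by simp
    rw [e]
    rcases le_total 1 t with h | h
    · have := Real.rpow_le_rpow_of_exponent_le h (by linarith : ν.re - 1 ≤ A - 1)
      have : 0 < t ^ (-A - 1) := by positivity
      linarith
    · have := Real.rpow_le_rpow_of_exponent_ge ht h (by linarith : -A - 1 ≤ ν.re - 1)
      have : 0 < t ^ (A - 1) := by positivity
      linarith
  have hker : ‖besselKernel y t‖ ≤ besselKernel (y₀ / 2) t * Real.exp (-(y / 2)) := by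
    rw [besselKernel, besselKernel, Real.norm_of_nonneg (Real.exp_nonneg _), ← Real.exp_add]
    apply Real.exp_le_exp.2
    have := two_le_add_one_div ht
    nlinarith
  exact mul_le_mul hpow hker (norm_nonneg _) (by positivity)

/-- The substitution `t = ru`. With `w = 2πmβ` and `r = m/β` the exponent becomes `-π(β²t + m²/t)`,
the form produced by Poisson summation. -/
theorem integral_cpow_mul_exp_eq_besselK (ν : ℂ) (w : ℝ) {r : ℝ} (hr : 0 < r) :
    ∫ t : ℝ in Set.Ioi 0, (t : ℂ) ^ (ν - 1) * (Real.exp (-(w * (t / r + r / t) / 2)) : ℂ) =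
      (r : ℂ) ^ ν * (2 * besselK ν w) := by
  have h := mellin_comp_mul_left (fun t => (besselKernel w t : ℂ)) ν (inv_pos.2 hr)
  rw [besselK_eq_mellin, ← mul_assoc (2 : ℂ)]
  have h3 : (2 : ℂ) * (1 / 2) = 1 := by norm_num
  have h4 : (((r⁻¹ : ℝ)) : ℂ) ^ (-ν) = (r : ℂ) ^ ν := by
    rw [Complex.ofReal_inv, Complex.inv_cpow _ _ (by
      rw [Complex.arg_ofReal_of_nonneg hr.le]; exact Real.pi_pos.ne), Complex.cpow_neg, inv_inv]
  rw [h3, one_mul, ← h4, ← smul_eq_mul, ← h, mellin]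
  refine setIntegral_congr_fun measurableSet_Ioi fun t ht => ?_
  have ht : 0 < t := ht
  simp only [besselKernel, smul_eq_mul]
  congr 4
  field_simp

theorem besselKernel_one_le {ε t : ℝ} (hε : 0 < ε) (ht : 0 < t) (h : ε ≤ |t - 1|) :
    besselKernel 1 t ≤ besselKernel 1 1 * Real.exp (-(ε ^ 2 / (1 + ε) / 2)) := by
  rw [besselKernel, besselKernel, ← Real.exp_add]
  apply Real.exp_le_exp.2
  have h1 : t + 1 / t - 2 = (t - 1) ^ 2 / t := by field_simp; ring
  have h2 : ε ^ 2 / (1 + ε) ≤ (t - 1) ^ 2 / t := by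
    rw [div_le_div_iff₀ (by positivity) ht]
    rcases le_abs.1 h with h | h
    · nlinarith [mul_nonneg (mul_nonneg (hε.le.trans h) hε.le) (sub_nonneg.2 h)]
    · have : ε ^ 2 ≤ (t - 1) ^ 2 := by nlinarith
      nlinarith [sq_nonneg ε, sq_nonneg (t - 1), mul_nonneg (sq_nonneg (t - 1)) hε.le]
  linarith

/-- Laplace's method. The powers of `c(t) = exp(-(t + 1/t)/2)`, normalized, concentrate at its
strict maximum `t = 1`. If `K_ν` vanished at every positive integer, all the integrals of these
peaks against `t^(ν-1) c(t)` would be zero, while they tend to `c(1) ≠ 0`. For some `ν` the function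
`K_ν` has positive zeros, so only the existence of one good `y` is claimed. -/
theorem exists_besselK_ne_zero (ν : ℂ) : ∃ y : ℝ, 0 < y ∧ besselK ν y ≠ 0 := by
  by_contra! hzero
  set c : ℝ → ℝ := besselKernel 1 with hc
  have hcpos : ∀ t, 0 < c t := fun t => Real.exp_pos _
  have hcpow : ∀ (n : ℕ) t, c t ^ n = besselKernel n t := by
    intro n t
    rw [hc, besselKernel, besselKernel, ← Real.exp_nat_mul]
    congr 1; ring
  set g : ℝ → ℂ := fun t => (t : ℂ) ^ (ν - 1) • (c t : ℂ) with hg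
  have hgint : IntegrableOn g (Set.Ioi 0) := mellinConvergent_besselKernel one_pos ν
  set t0 : Set ℝ := Set.Icc (1 / 2) 2 with ht0
  have ht0sub : t0 ⊆ Set.Ioi 0 := fun t ht => lt_of_lt_of_le (by norm_num) ht.1
  have hcc : ContinuousOn c (Set.Ioi 0) := continuousOn_besselKernel 1
  set φ : ℕ → ℝ → ℝ := fun n t => (∫ u in t0, c u ^ n)⁻¹ * c t ^ n with hφ
  have hIpos : ∀ n : ℕ, 0 < ∫ u in t0, c u ^ n := by
    intro n
    have hint : IntegrableOn (fun u => c u ^ n) t0 :=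
      ((hcc.mono ht0sub).pow n).integrableOn_Icc
    rw [setIntegral_pos_iff_support_of_nonneg_ae
      (Filter.Eventually.of_forall fun u => (pow_pos (hcpos u) n).le) hint]
    have : Function.support (fun u => c u ^ n) = Set.univ := by
      ext u; simp [(hcpos u).ne']
    rw [this, Set.univ_inter, ht0, Real.volume_Icc]
    norm_num
  have key : Filter.Tendsto (fun n : ℕ => ∫ t in Set.Ioi 0, φ n t • g t) Filter.atTop
      (nhds (g 1)) := by
    refine tendsto_setIntegral_peak_smul_of_integrableOn_of_tendsto (x₀ := 1) (t := t0)
      measurableSet_Ioi measurableSet_Icc ht0sub ?_ ?_ ?_ ?_ ?_ ?_ hgint ?_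
    · exact mem_nhdsWithin_of_mem_nhds (Icc_mem_nhds (by norm_num) (by norm_num))
    · rw [ht0, Real.volume_Icc]; exact ENNReal.ofReal_ne_top
    · refine Filter.Eventually.of_forall fun n t _ => ?_
      exact mul_nonneg (inv_nonneg.2 (hIpos n).le) (pow_pos (hcpos t) n).le
    · intro u hu h1u
      obtain ⟨ε, hε, hball⟩ := Metric.isOpen_iff.1 hu 1 h1u
      -- By `besselKernel_one_le`, `ρ` bounds `c` outside the `ε`-ball about `1`.
      set ρ := c 1 * Real.exp (-(ε ^ 2 / (1 + ε) / 2)) with hρ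
      have hρ1 : ρ < c 1 :=
        mul_lt_of_lt_one_right (hcpos 1) (Real.exp_lt_one_iff.2 (by
          have : 0 < ε ^ 2 / (1 + ε) / 2 := by positivity
          linarith))
      have hρ0 : 0 < ρ := mul_pos (hcpos 1) (Real.exp_pos _)
      -- On an interval of length `η'` starting at `1` the kernel exceeds `ρ'`, so the normalizing
      -- integral is at least `η' ρ'^n`. Off the ball the peak is then at most `(ρ/ρ')^n / η'`,
      -- which tends to `0`.
      obtain ⟨ρ', hρρ', hρ'1⟩ := exists_between hρ1
      have hnear : ∀ᶠ t in nhds (1 : ℝ), ρ' < c t :=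
        (hcc.continuousAt (Ioi_mem_nhds one_pos)).eventually (lt_mem_nhds hρ'1)
      obtain ⟨η, hη, hηball⟩ := Metric.eventually_nhds_iff.1 hnear
      set η' := min (η / 2) 1 with hη'
      have hη'0 : 0 < η' := by positivity
      have hlow : ∀ n : ℕ, η' * ρ' ^ n ≤ ∫ u in t0, c u ^ n := by
        intro n
        have hsub : Set.Icc 1 (1 + η') ⊆ t0 :=
          Set.Icc_subset_Icc (by norm_num) (by linarith [min_le_right (η / 2) 1])
        have hint : IntegrableOn (fun u => c u ^ n) t0 :=
          ((hcc.mono ht0sub).pow n).integrableOn_Icc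
        calc η' * ρ' ^ n = ∫ _ in Set.Icc 1 (1 + η'), ρ' ^ n := by
              simp [Measure.real, Real.volume_Icc, hη'0.le]
          _ ≤ ∫ u in Set.Icc 1 (1 + η'), c u ^ n := by
              refine setIntegral_mono_on (by simp) (hint.mono_set hsub) measurableSet_Icc ?_
              intro t ht
              have : ρ' < c t := by
                apply hηball
                rw [Real.dist_eq, abs_of_nonneg (by linarith [ht.1])]
                linarith [ht.2, min_le_left (η / 2) 1]
              exact pow_le_pow_left₀ (hρ0.trans hρρ').le this.le n
          _ ≤ ∫ u in t0, c u ^ n :=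
              setIntegral_mono_set hint
                (Filter.Eventually.of_forall fun u => (pow_pos (hcpos u) n).le) hsub.eventuallyLE
      rw [Metric.tendstoUniformlyOn_iff]
      intro δ hδ
      have hlim : Filter.Tendsto (fun n : ℕ => (ρ / ρ') ^ n / η') Filter.atTop (nhds 0) := by
        have := (tendsto_pow_atTop_nhds_zero_of_lt_one (div_pos hρ0 (hρ0.trans hρρ')).le
          ((div_lt_one (hρ0.trans hρρ')).2 hρρ')).div_const η'
        simpa using this
      filter_upwards [hlim.eventually (gt_mem_nhds hδ)] with n hn t ht
      have ht0 : 0 < t := ht.1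
      have hd : ε ≤ |t - 1| := by
        by_contra! hlt
        exact ht.2 (hball (by rwa [Metric.mem_ball, Real.dist_eq]))
      have hρ'n : 0 < ρ' ^ n := pow_pos (hρ0.trans hρρ') n
      refine lt_of_le_of_lt ?_ hn
      simp only [Pi.zero_apply, hφ]
      rw [dist_zero_left, Real.norm_of_nonneg (mul_nonneg (inv_nonneg.2 (hIpos n).le)
        (pow_pos (hcpos t) n).le), inv_mul_eq_div, div_pow, div_div, mul_comm _ η']
      exact div_le_div₀ (pow_pos hρ0 n).le
        (pow_le_pow_left₀ (hcpos t).le (besselKernel_one_le hε ht0 hd) n) (by positivity) (hlow n)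
    · refine tendsto_const_nhds.congr fun n => ?_
      simp only [hφ]
      rw [integral_const_mul, inv_mul_cancel₀ (hIpos n).ne']
    · refine Filter.Eventually.of_forall fun n => ?_
      exact (continuousOn_const.mul (hcc.pow n)).aestronglyMeasurable measurableSet_Ioi
    · have : ContinuousAt g 1 := by
        apply ContinuousAt.mul
        · exact Complex.continuousAt_ofReal_cpow_const _ _ (Or.inr one_ne_zero)
        · exact Complex.continuous_ofReal.continuousAt.comp
            (hcc.continuousAt (Ioi_mem_nhds one_pos))
      exact this.tendsto.mono_left nhdsWithin_le_nhds
  have hz : ∀ n : ℕ, ∫ t in Set.Ioi 0, φ n t • g t = 0 := by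
    intro n
    -- The exponent is `n + 1` because `g` already contains one factor `c`.
    have h1 := hzero (n + 1 : ℕ) (by positivity)
    rw [besselK_eq_mellin, mul_eq_zero, or_iff_right (by norm_num), mellin] at h1
    have : ∀ t, φ n t • g t = (((∫ u in t0, c u ^ n)⁻¹ : ℝ) : ℂ) *
        ((t : ℂ) ^ (ν - 1) • (besselKernel (n + 1 : ℕ) t : ℂ)) := by
      intro t
      rw [← hcpow, hφ, hg]
      simp only [Complex.real_smul, smul_eq_mul]
      push_cast
      ring
    simp_rw [this]
    rw [integral_const_mul, h1, mul_zero]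
  simp_rw [hz] at key
  have h0 := tendsto_nhds_unique key tendsto_const_nhds
  simp only [hg, Complex.ofReal_one, Complex.one_cpow, one_smul] at h0
  exact (hcpos 1).ne' (Complex.ofReal_eq_zero.1 h0)

/-! ### Lattice sums -/

/-- `Im γ(x + iy)` for a matrix `γ` of determinant one with bottom row `v`. -/
noncomputable def imForm (x y : ℝ) (v : ℤ × ℤ) : ℝ :=
  y / ((v.1 * x + v.2) ^ 2 + (v.1 * y) ^ 2)

/-- The sum `∑ (y / |cz + d| ^ 2) ^ s` over all pairs of integers `(c, d)`. -/
noncomputable def latticeSum (x y : ℝ) (s : ℂ) : ℂ := ∑' v : ℤ × ℤ, (imForm x y v : ℂ) ^ s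

/-- The primitive pairs of integers. -/
def primitivePairs : Set (ℤ × ℤ) := {u | IsCoprime u.1 u.2}

theorem imForm_nonneg (x : ℝ) {y : ℝ} (hy : 0 < y) (v : ℤ × ℤ) : 0 ≤ imForm x y v := by
  unfold imForm; positivity

/-- Division by zero makes this value `0`, so the origin may stay in the lattice sum without
contributing when `s ≠ 0`. -/
theorem imForm_zero (x y : ℝ) : imForm x y 0 = 0 := by simp [imForm]

theorem imForm_neg (x y : ℝ) (v : ℤ × ℤ) : imForm x y (-v) = imForm x y v := by
  simp only [imForm, Prod.fst_neg, Prod.snd_neg, Int.cast_neg]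
  congr 1
  ring

theorem imForm_mul (x y : ℝ) (n : ℕ+) (u : ℤ × ℤ) :
    imForm x y ((n : ℤ) * u.1, (n : ℤ) * u.2) = ((n : ℝ) ^ 2)⁻¹ * imForm x y u := by
  simp only [imForm, Int.cast_mul]
  rw [← one_div, div_mul_div_comm, one_mul]
  congr 1
  push_cast
  ring

theorem imForm_mul_cpow (x : ℝ) {y : ℝ} (hy : 0 < y) (n : ℕ+) (u : ℤ × ℤ) (s : ℂ) :
    (imForm x y ((n : ℤ) * u.1, (n : ℤ) * u.2) : ℂ) ^ s =
      1 / ((n : ℕ) : ℂ) ^ (2 * s) * (imForm x y u : ℂ) ^ s := by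
  rw [imForm_mul, Complex.ofReal_mul, Complex.mul_cpow_ofReal_nonneg (by positivity)
    (imForm_nonneg x hy u)]
  congr 1
  have hn : ((n : ℕ) : ℂ) ^ (2 * s) = ((((n : ℕ) : ℝ) ^ 2 : ℝ) : ℂ) ^ s := by
    have h : ((n : ℕ) : ℂ) ^ (2 * s) = (((n : ℕ) : ℂ) ^ (2 : ℕ)) ^ s := by
      have := Complex.natCast_cpow_natCast_mul (n : ℕ) 2 s
      simpa using this
    rw [h]; push_cast; rfl
  rw [hn, one_div, Complex.ofReal_inv, Complex.inv_cpow]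
  rw [Complex.arg_ofReal_of_nonneg (by positivity)]
  exact Real.pi_pos.ne

theorem summable_imForm_rpow (x : ℝ) {y : ℝ} (hy : 0 < y) {σ : ℝ} (hσ : 1 < σ) :
    Summable fun v : ℤ × ℤ => imForm x y v ^ σ := by
  set z : ℍ := ⟨⟨x, y⟩, hy⟩ with hz
  have h1 := (EisensteinSeries.summable_one_div_norm_rpow (k := 2 * σ) (by linarith)).mul_left
    (y ^ σ * EisensteinSeries.r z ^ (-(2 * σ)))
  rw [← (finTwoArrowEquiv ℤ).symm.summable_iff] at h1
  refine h1.of_nonneg_of_le (fun v => Real.rpow_nonneg (imForm_nonneg x hy v) _) fun v => ?_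
  have h2 := EisensteinSeries.summand_bound z (k := 2 * σ) (by linarith)
    ((finTwoArrowEquiv ℤ).symm v)
  have h3 : imForm x y v ^ σ = y ^ σ *
      ‖(((finTwoArrowEquiv ℤ).symm v 0 : ℤ) : ℂ) * (z : ℂ) +
        (((finTwoArrowEquiv ℤ).symm v 1 : ℤ) : ℂ)‖ ^ (-(2 * σ)) := by
    have h4 : (v.1 * x + v.2) ^ 2 + (v.1 * y) ^ 2 =
      ‖(((finTwoArrowEquiv ℤ).symm v 0 : ℤ) : ℂ) * (z : ℂ) +
        (((finTwoArrowEquiv ℤ).symm v 1 : ℤ) : ℂ)‖ ^ 2 := by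
      rw [← Complex.normSq_eq_norm_sq, Complex.normSq_apply]
      simp [hz]
      ring
    rw [imForm, h4, Real.div_rpow hy.le (sq_nonneg _), Real.rpow_neg (norm_nonneg _),
      Real.rpow_mul (norm_nonneg _), div_eq_mul_inv, Real.rpow_two]
  rw [h3, Function.comp, mul_assoc]
  exact mul_le_mul_of_nonneg_left h2 (by positivity)

theorem norm_imForm_cpow (x : ℝ) {y : ℝ} (hy : 0 < y) {s : ℂ} (hs : 0 < s.re) (v : ℤ × ℤ) :
    ‖(imForm x y v : ℂ) ^ s‖ = imForm x y v ^ s.re :=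
  Complex.norm_cpow_eq_rpow_re_of_nonneg (imForm_nonneg x hy v) hs.ne'

theorem summable_imForm_cpow (x : ℝ) {y : ℝ} (hy : 0 < y) {s : ℂ} (hs : 1 < s.re) :
    Summable fun v : ℤ × ℤ => (imForm x y v : ℂ) ^ s := by
  apply Summable.of_norm
  simp_rw [norm_imForm_cpow x hy (one_pos.trans hs)]
  exact summable_imForm_rpow x hy hs

/-- The new point is `-1/z`, and `(c,d) ↦ (d,-c)` permutes the lattice and matches the two sums term
by term. -/
theorem latticeSum_inversion (x y : ℝ) (hy : 0 < y) (s : ℂ) :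
    latticeSum (-x / (x ^ 2 + y ^ 2)) (y / (x ^ 2 + y ^ 2)) s = latticeSum x y s := by
  have hpos : 0 < x ^ 2 + y ^ 2 := by positivity
  rw [latticeSum, latticeSum, ← ((Equiv.prodComm ℤ ℤ).trans
    (Equiv.prodCongr (Equiv.refl ℤ) (Equiv.neg ℤ))).tsum_eq (fun v => (imForm x y v : ℂ) ^ s)]
  refine tsum_congr fun v => ?_
  congr 2
  simp only [imForm, Equiv.trans_apply, Equiv.prodComm_apply, Equiv.prodCongr_apply, Prod.map,
    Prod.swap, Equiv.refl_apply, Equiv.neg_apply, Int.cast_neg]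
  rw [div_div]
  congr 1
  field_simp
  ring

/-- Every nonzero pair is `n u` for exactly one positive `n`, its gcd, and one primitive `u`. -/
theorem tsum_eq_tsum_primitivePairs {g : ℤ × ℤ → ℂ} (hg : Summable g) (hg0 : g 0 = 0) :
    ∑' v, g v = ∑' u, primitivePairs.indicator
      (fun u => ∑' n : ℕ+, g ((n : ℤ) * u.1, (n : ℤ) * u.2)) u := by
  rw [← tsum_subtype]
  set φ : primitivePairs × ℕ+ → ℤ × ℤ := fun w => ((w.2 : ℤ) * w.1.1.1, (w.2 : ℤ) * w.1.1.2)
    with hφ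
  have hinj : Function.Injective φ := by
    rintro ⟨⟨u, hu⟩, n⟩ ⟨⟨u', hu'⟩, n'⟩ h
    simp only [hφ, Prod.mk.injEq] at h
    have hu := Int.isCoprime_iff_gcd_eq_one.1 hu
    have hu' := Int.isCoprime_iff_gcd_eq_one.1 hu'
    have h1 := Int.gcd_mul_left (n : ℤ) u.1 u.2
    have h2 := Int.gcd_mul_left (n' : ℤ) u'.1 u'.2
    rw [h.1, h.2, h2, hu, hu'] at h1
    simp only [mul_one, Int.natAbs_natCast] at h1
    have hn : n = n' := (PNat.coe_injective h1).symm
    subst hn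
    have hn0 : ((n : ℕ) : ℤ) ≠ 0 := by exact_mod_cast n.ne_zero
    have e : u = u' := Prod.ext (mul_left_cancel₀ hn0 h.1) (mul_left_cancel₀ hn0 h.2)
    subst e
    rfl
  have hrange : Function.support g ⊆ Set.range φ := by
    intro v hv
    have hv0 : v ≠ 0 := fun h => hv (by rw [h, hg0])
    have hgcd : 0 < Int.gcd v.1 v.2 := by
      rw [Int.gcd_pos_iff]
      by_contra! h
      exact hv0 (Prod.ext h.1 h.2)
    refine ⟨⟨⟨(v.1 / Int.gcd v.1 v.2, v.2 / Int.gcd v.1 v.2),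
      isCoprime_div_gcd_div_gcd_of_gcd_ne_zero ?_⟩, ⟨_, hgcd⟩⟩, ?_⟩
    · rw [← Int.coe_gcd]
      exact_mod_cast hgcd.ne'
    · simp only [hφ, PNat.mk_coe]
      exact Prod.ext (Int.mul_ediv_cancel' (Int.gcd_dvd_left ..))
        (Int.mul_ediv_cancel' (Int.gcd_dvd_right ..))
  rw [← hinj.tsum_eq hrange]
  have hs : Summable (g ∘ φ) := hg.comp_injective hinj
  exact hs.tsum_prod

theorem zeta_eq_tsum_pnat {s : ℂ} (hs : 1 < s.re) :
    riemannZeta s = ∑' n : ℕ+, 1 / ((n : ℕ) : ℂ) ^ s := by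
  rw [zeta_eq_tsum_one_div_nat_add_one_cpow hs, tsum_pnat_eq_tsum_succ
    (f := fun n : ℕ => 1 / (n : ℂ) ^ s)]
  simp

theorem latticeSum_eq_zeta_mul (x : ℝ) {y : ℝ} (hy : 0 < y) {s : ℂ} (hs : 1 < s.re) :
    latticeSum x y s = riemannZeta (2 * s) *
      ∑' u, primitivePairs.indicator (fun u => (imForm x y u : ℂ) ^ s) u := by
  have hs0 : s ≠ 0 := by rintro rfl; simp at hs; linarith
  have h2s : 1 < (2 * s).re := by simp; linarith
  rw [latticeSum, tsum_eq_tsum_primitivePairs (summable_imForm_cpow x hy hs)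
    (by rw [imForm_zero, Complex.ofReal_zero, Complex.zero_cpow hs0]), ← tsum_mul_left]
  refine tsum_congr fun u => ?_
  by_cases hu : u ∈ primitivePairs
  · simp only [Set.indicator_of_mem hu, imForm_mul_cpow x hy]
    rw [tsum_mul_right, zeta_eq_tsum_pnat h2s]
  · simp [Set.indicator_of_notMem hu]

theorem imForm_dilate (p : ℕ) (x y : ℝ) (v : ℤ × ℤ) :
    imForm (p * x) (p * y) v = p * imForm x y ((p : ℤ) * v.1, v.2) := by
  simp only [imForm]
  rw [← mul_div_assoc]
  congr 1
  push_cast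
  ring

theorem imForm_dilate_cpow (p : ℕ) (x : ℝ) {y : ℝ} (hy : 0 < y) (s : ℂ) (v : ℤ × ℤ) :
    (imForm (p * x) (p * y) v : ℂ) ^ s =
      (p : ℂ) ^ s * (imForm x y ((p : ℤ) * v.1, v.2) : ℂ) ^ s := by
  rw [imForm_dilate, Complex.ofReal_mul, Complex.mul_cpow_ofReal_nonneg (by positivity)
    (imForm_nonneg x hy _), Complex.ofReal_natCast]

/-- The pair `(c,d)` at `pz` is the pair `(pc,d)` at `z`, so the sum runs over pairs with `p ∣ c`.
Writing such a pair as `n u` with `u` primitive, either `p ∣ u.1` and `n` is arbitrary, or `p ∣ n`,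
which costs the factor `p^(-2s)`. -/
theorem latticeSum_dilate {p : ℕ} (hp : p.Prime) (x : ℝ) {y : ℝ} (hy : 0 < y) {s : ℂ}
    (hs : 1 < s.re) :
    latticeSum (p * x) (p * y) s = (p : ℂ) ^ s * (riemannZeta (2 * s) *
      (∑' u, (primitivePairs ∩ {u | (p : ℤ) ∣ u.1}).indicator (fun u => (imForm x y u : ℂ) ^ s) u +
        1 / (p : ℂ) ^ (2 * s) * ∑' u, (primitivePairs ∩ {u | ¬ (p : ℤ) ∣ u.1}).indicator
          (fun u => (imForm x y u : ℂ) ^ s) u)) := by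
  have hs0 : s ≠ 0 := by rintro rfl; simp at hs; linarith
  have h2s : 1 < (2 * s).re := by simp; linarith
  have hp0 : (p : ℤ) ≠ 0 := by exact_mod_cast hp.ne_zero
  have hsum := summable_imForm_cpow x hy hs
  rw [latticeSum]
  simp_rw [imForm_dilate_cpow p x hy]
  rw [tsum_mul_left]
  congr 1
  set g : ℤ × ℤ → ℂ := {v : ℤ × ℤ | (p : ℤ) ∣ v.1}.indicator (fun v => (imForm x y v : ℂ) ^ s)
    with hg
  have hg1 : ∑' v : ℤ × ℤ, (imForm x y ((p : ℤ) * v.1, v.2) : ℂ) ^ s = ∑' v, g v := by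
    have hinj : Function.Injective (fun v : ℤ × ℤ => ((p : ℤ) * v.1, v.2)) := by
      rintro ⟨a, b⟩ ⟨c, d⟩ h
      simp only [Prod.mk.injEq] at h
      exact Prod.ext (mul_left_cancel₀ hp0 h.1) h.2
    rw [← hinj.tsum_eq (f := g)]
    · refine tsum_congr fun v => ?_
      rw [hg, Set.indicator_of_mem (s := {v : ℤ × ℤ | (p : ℤ) ∣ v.1})]
      exact dvd_mul_right _ _
    · intro v hv
      have : v ∈ {v : ℤ × ℤ | (p : ℤ) ∣ v.1} := Set.mem_of_indicator_ne_zero hv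
      obtain ⟨k, hk⟩ := this
      exact ⟨(k, v.2), Prod.ext hk.symm rfl⟩
  have hgs : Summable g := hsum.indicator _
  rw [hg1, tsum_eq_tsum_primitivePairs hgs (by
    rw [hg, Set.indicator_of_mem (by simp), imForm_zero, Complex.ofReal_zero,
      Complex.zero_cpow hs0]), ← tsum_mul_left, ← Summable.tsum_add (hsum.indicator _)
      ((hsum.indicator _).mul_left _), ← tsum_mul_left]
  refine tsum_congr fun u => ?_
  by_cases hu : u ∈ primitivePairs
  swap
  · simp [Set.indicator_of_notMem, hu]
  rw [Set.indicator_of_mem hu]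
  by_cases hpu : (p : ℤ) ∣ u.1
  · rw [Set.indicator_of_mem (show u ∈ primitivePairs ∩ {u | (p : ℤ) ∣ u.1} from ⟨hu, hpu⟩),
      Set.indicator_of_notMem (fun h => h.2 hpu), mul_zero, add_zero, zeta_eq_tsum_pnat h2s,
      ← tsum_mul_right]
    refine tsum_congr fun n => ?_
    rw [hg, Set.indicator_of_mem (dvd_mul_of_dvd_right hpu _ : _ ∈ {v : ℤ × ℤ | (p : ℤ) ∣ v.1}),
      imForm_mul_cpow x hy]
  · rw [Set.indicator_of_notMem (fun h => hpu h.2), zero_add,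
      Set.indicator_of_mem (show u ∈ primitivePairs ∩ {u | ¬ (p : ℤ) ∣ u.1} from ⟨hu, hpu⟩),
      zeta_eq_tsum_pnat h2s, ← tsum_mul_right]
    -- Here `p ∤ u.1`, so only the multiples `n = P k` contribute.
    obtain ⟨P, hP⟩ : ∃ P : ℕ+, (P : ℕ) = p := ⟨⟨p, hp.pos⟩, rfl⟩
    have hinj : Function.Injective (fun n : ℕ+ => P * n) := fun a b h => mul_left_cancel h
    rw [← hinj.tsum_eq (f := fun n : ℕ+ => g ((n : ℤ) * u.1, (n : ℤ) * u.2))]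
    · refine tsum_congr fun n => ?_
      rw [hg, Set.indicator_of_mem, imForm_mul_cpow x hy]
      · rw [PNat.mul_coe, hP, Nat.cast_mul, Complex.natCast_mul_natCast_cpow]
        ring
      · change (p : ℤ) ∣ ((P * n : ℕ+) : ℕ) * u.1
        rw [PNat.mul_coe, hP, Nat.cast_mul, mul_assoc]
        exact dvd_mul_right _ _
    · intro n hn
      have h1 : (p : ℤ) ∣ ((n : ℕ) : ℤ) * u.1 :=
        Set.mem_of_indicator_ne_zero (s := {v : ℤ × ℤ | (p : ℤ) ∣ v.1}) hn
      have h2 : p ∣ (n : ℕ) := by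
        have := ((Nat.prime_iff_prime_int.1 hp).dvd_or_dvd h1).resolve_right hpu
        exact_mod_cast this
      obtain ⟨k, hk⟩ := h2
      have hk0 : 0 < k := Nat.pos_of_ne_zero (by rintro rfl; simp at hk)
      exact ⟨⟨k, hk0⟩, PNat.coe_injective (by rw [hk, ← hP]; rfl)⟩

theorem tsum_primitivePairs_split (p : ℕ) (x : ℝ) {y : ℝ} (hy : 0 < y) {s : ℂ} (hs : 1 < s.re) :
    ∑' u, primitivePairs.indicator (fun u => (imForm x y u : ℂ) ^ s) u =
      ∑' u, (primitivePairs ∩ {u | (p : ℤ) ∣ u.1}).indicator (fun u => (imForm x y u : ℂ) ^ s) u +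
      ∑' u, (primitivePairs ∩ {u | ¬ (p : ℤ) ∣ u.1}).indicator
        (fun u => (imForm x y u : ℂ) ^ s) u := by
  have hsum := summable_imForm_cpow x hy hs
  rw [← Summable.tsum_add (hsum.indicator _) (hsum.indicator _)]
  refine tsum_congr fun u => ?_
  by_cases hu : u ∈ primitivePairs <;> by_cases hpu : (p : ℤ) ∣ u.1 <;>
    simp [hu, hpu]

variable {Γ : Subgroup SL(2, ℤ)}

/-! ### Eisenstein series as sums over primitive pairs -/

theorem im_smul_eq (g : SL(2, ℝ)) (z : ℍ) :
    (g • z).im = z.im / ((g 1 0 * z.re + g 1 1) ^ 2 + (g 1 0 * z.im) ^ 2) := by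
  have h := UpperHalfPlane.im_smul_eq_div_normSq (g : GL (Fin 2) ℝ) z
  have hd : |((g : GL (Fin 2) ℝ)).det.val| = 1 := by simp
  rw [hd, one_mul] at h
  have h4 : denom (g : GL (Fin 2) ℝ) z = (g 1 0 : ℂ) * z + (g 1 1 : ℂ) := rfl
  rw [h4, Complex.normSq_apply] at h
  refine h.trans ?_
  congr 1
  simp
  ring

theorem ScaledCusp.imAt_mk (𝔞 : ScaledCusp Γ) (z : ℍ) (γ : Γ) :
    𝔞.imAt z (Quotient.mk _ γ) = ((𝔞.scaling⁻¹ * toReal γ) • z).im := by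
  rw [mul_smul]; rfl

/-- Bézout coefficients of `u` give the ratio `t` of the proportional vectors as an integer; those
of `v` show that `t` is a unit. -/
theorem eq_or_eq_neg_of_det_eq_zero {u v : ℤ × ℤ} (hu : IsCoprime u.1 u.2)
    (hv : IsCoprime v.1 v.2) (h : u.1 * v.2 = u.2 * v.1) : v = u ∨ v = -u := by
  obtain ⟨a, b, hab⟩ := hu
  obtain ⟨c, d, hcd⟩ := hv
  set t := a * v.1 + b * v.2 with ht
  have h1 : v.1 = t * u.1 := by rw [ht]; linear_combination (-b) * h - v.1 * hab
  have h2 : v.2 = t * u.2 := by rw [ht]; linear_combination a * h - v.2 * hab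
  have h3 : (c * u.1 + d * u.2) * t = 1 := by rw [h1, h2] at hcd; linear_combination hcd
  rcases Int.isUnit_iff.1 (IsUnit.of_mul_eq_one_right _ h3) with h4 | h4
  · left; rw [h4] at h1 h2; exact Prod.ext (by simpa using h1) (by simpa using h2)
  · right; rw [h4] at h1 h2; exact Prod.ext (by simpa using h1) (by simpa using h2)

/-- If the cosets `Γ_𝔞 \ Γ` are parametrized up to sign by the elements of a set `S` of primitive
pairs, the Eisenstein series is half the sum over `S`. -/
theorem two_mul_eisensteinSeries (𝔞 : ScaledCusp Γ) (z : ℍ) (s : ℂ) (row : Γ → ℤ × ℤ)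
    (S : Set (ℤ × ℤ)) (f : ℤ × ℤ → ℝ) (hS : S ⊆ primitivePairs) (hrow : ∀ γ, row γ ∈ S)
    (hneg : ∀ v ∈ S, -v ∈ S) (hsurj : ∀ v ∈ S, ∃ γ, row γ = v)
    (hst : ∀ γ γ' : Γ, γ' * γ⁻¹ ∈ 𝔞.stab ↔ (row γ).1 * (row γ').2 = (row γ).2 * (row γ').1)
    (him : ∀ γ : Γ, 𝔞.imAt z (Quotient.mk _ γ) = f (row γ)) (hf : ∀ v, f (-v) = f v)
    (hsum : Summable fun v : ℤ × ℤ => (f v : ℂ) ^ s) :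
    2 * eisensteinSeries 𝔞 z s = ∑' v, S.indicator (fun v => (f v : ℂ) ^ s) v := by
  have hst' : ∀ γ γ' : Γ, γ' * γ⁻¹ ∈ 𝔞.stab ↔ row γ' = row γ ∨ row γ' = -row γ := by
    intro γ γ'
    rw [hst]
    constructor
    · exact eq_or_eq_neg_of_det_eq_zero (hS (hrow γ)) (hS (hrow γ'))
    · rintro (h | h) <;> rw [h]
      · ring
      · simp; ring
  -- The origin is not primitive, so each coset accounts for exactly two pairs.
  have hne : ∀ v ∈ S, v ≠ -v := by
    intro v hv h
    have h1 : v.1 = 0 := by have := congrArg Prod.fst h; simp at this; omega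
    have h2 : v.2 = 0 := by have := congrArg Prod.snd h; simp at this; omega
    obtain ⟨a, b, hab⟩ : IsCoprime v.1 v.2 := hS hv
    simp [h1, h2] at hab
  -- A coset and a sign determine a pair, through the row of the chosen representative. That `ψ` is
  -- bijective is the source of the factor `2`.
  set ψ : 𝔞.Cosets × Bool → S := fun w =>
    if w.2 then ⟨row w.1.out, hrow _⟩ else ⟨-row w.1.out, hneg _ (hrow _)⟩ with hψ
  have hψt : ∀ q, (ψ (q, true) : ℤ × ℤ) = row q.out := fun q => by simp [hψ]
  have hψf : ∀ q, (ψ (q, false) : ℤ × ℤ) = -row q.out := fun q => by simp [hψ]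
  have hq : ∀ q q' : 𝔞.Cosets, row q'.out = row q.out ∨ row q'.out = -row q.out → q = q' := by
    intro q q' h
    have h1 := (hst' q.out q'.out).2 h
    have h2 : Quotient.mk (QuotientGroup.rightRel 𝔞.stab) q.out = Quotient.mk _ q'.out :=
      Quotient.sound (QuotientGroup.rightRel_apply.2 h1)
    rwa [Quotient.out_eq, Quotient.out_eq] at h2
  have hbij : Function.Bijective ψ := by
    constructor
    · rintro ⟨q, b⟩ ⟨q', b'⟩ h
      have h' := congrArg (Subtype.val) h
      cases b <;> cases b' <;> simp only [hψt, hψf] at h'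
      · rw [hq q q' (Or.inl (neg_injective h').symm)]
      · have := hq q q' (Or.inr h'.symm)
        subst this
        exact absurd h'.symm (hne _ (hrow _))
      · have := hq q' q (Or.inr h')
        subst this
        exact absurd h' (hne _ (hrow _))
      · rw [hq q q' (Or.inl h'.symm)]
    · rintro ⟨v, hv⟩
      obtain ⟨γ, rfl⟩ := hsurj v hv
      set q : 𝔞.Cosets := Quotient.mk _ γ with hqdef
      have h1 : (QuotientGroup.rightRel 𝔞.stab) q.out γ := Quotient.exact (by rw [Quotient.out_eq])
      rcases (hst' q.out γ).1 (QuotientGroup.rightRel_apply.1 h1) with h | h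
      · exact ⟨(q, true), Subtype.ext ((hψt q).trans h.symm)⟩
      · exact ⟨(q, false), Subtype.ext ((hψf q).trans h.symm)⟩
  have hval : ∀ w, ((f (ψ w : ℤ × ℤ) : ℝ) : ℂ) ^ s = (𝔞.imAt z w.1 : ℂ) ^ s := by
    rintro ⟨q, b⟩
    have h1 : 𝔞.imAt z q = f (row q.out) := by rw [← him, Quotient.out_eq]
    cases b
    · rw [hψf, hf, h1]
    · rw [hψt, h1]
  have hsumS : Summable fun v : S => (f (v : ℤ × ℤ) : ℂ) ^ s := hsum.subtype S
  have hsumψ := hsumS.comp_injective hbij.1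
  rw [← tsum_subtype, ← (Equiv.ofBijective ψ hbij).tsum_eq]
  simp only [Equiv.ofBijective_apply]
  refine hsumψ.tsum_prod.trans ?_ |>.symm
  rw [eisensteinSeries, ← tsum_mul_left]
  refine tsum_congr fun q => ?_
  simp only [Function.comp, hval]
  rw [tsum_fintype, Fintype.sum_bool, two_mul]

theorem isCoprime_row (g : SL(2, ℤ)) (i : Fin 2) : IsCoprime (g i 0) (g i 1) := g.isCoprime_row i

theorem inv_entries (g : SL(2, ℤ)) :
    g⁻¹ 0 0 = g 1 1 ∧ g⁻¹ 0 1 = -g 0 1 ∧ g⁻¹ 1 0 = -g 1 0 ∧ g⁻¹ 1 1 = g 0 0 := by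
  rw [Matrix.SpecialLinearGroup.SL2_inv_expl]
  simp

theorem mul_entry_int (g h : SL(2, ℤ)) (i j : Fin 2) :
    (g * h) i j = g i 0 * h 0 j + g i 1 * h 1 j := by
  change ((g : Matrix (Fin 2) (Fin 2) ℤ) * (h : Matrix (Fin 2) (Fin 2) ℤ)) i j = _
  rw [Matrix.mul_apply, Fin.sum_univ_two]

theorem ScaledCusp.mem_stab_of_infty (𝔞 : ScaledCusp Γ) (h : 𝔞.point = OnePoint.infty) (γ : Γ) :
    γ ∈ 𝔞.stab ↔ (γ : SL(2, ℤ)) 1 0 = 0 := by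
  change (mapGL ℝ (γ : SL(2, ℤ))) • 𝔞.point = 𝔞.point ↔ _
  rw [h, OnePoint.smul_infty_eq_self_iff]
  change (((γ : SL(2, ℤ)) 1 0 : ℤ) : ℝ) = 0 ↔ _
  exact Int.cast_eq_zero

theorem ScaledCusp.mem_stab_of_zero (𝔞 : ScaledCusp Γ) (h : 𝔞.point = ((0 : ℝ) : OnePoint ℝ))
    (γ : Γ) : γ ∈ 𝔞.stab ↔ (γ : SL(2, ℤ)) 0 1 = 0 := by
  change (mapGL ℝ (γ : SL(2, ℤ))) • 𝔞.point = 𝔞.point ↔ _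
  rw [h, OnePoint.smul_some_eq_ite]
  have h1 : (mapGL ℝ (γ : SL(2, ℤ))) 1 1 = (((γ : SL(2, ℤ)) 1 1 : ℤ) : ℝ) := rfl
  have h2 : (mapGL ℝ (γ : SL(2, ℤ))) 0 1 = (((γ : SL(2, ℤ)) 0 1 : ℤ) : ℝ) := rfl
  rw [mul_zero, mul_zero, zero_add, zero_add, h1, h2]
  have hdet := (γ : SL(2, ℤ)).det_coe
  rw [Matrix.det_fin_two] at hdet
  split_ifs with h3
  · constructor
    · intro h4; exact absurd h4 (OnePoint.infty_ne_coe _)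
    · intro h4
      rw [Int.cast_eq_zero] at h3
      rw [h3, h4] at hdet
      simp at hdet
  · rw [OnePoint.coe_eq_coe, div_eq_zero_iff, or_iff_left h3, Int.cast_eq_zero]

theorem ScaledCusp.imAt_mk_of_scaling_one (𝔞 : ScaledCusp Γ) (h : 𝔞.scaling = 1) (z : ℍ) (γ : Γ) :
    𝔞.imAt z (Quotient.mk _ γ) =
      imForm z.re z.im ((γ : SL(2, ℤ)) 1 0, (γ : SL(2, ℤ)) 1 1) := by
  rw [𝔞.imAt_mk, h, inv_one, one_mul, im_smul_eq]
  simp only [toReal_apply, imForm]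

/-- The lower left entry of `γ' γ⁻¹` is the determinant of the two bottom rows, so a coset is a
bottom row up to sign. The hypothesis on `S` says that membership in `Γ` is decided by the bottom
row. -/
theorem two_mul_eisensteinSeries_infty (𝔞 : ScaledCusp Γ) (h : 𝔞.point = OnePoint.infty)
    (h' : 𝔞.scaling = 1) (z : ℍ) {s : ℂ} (hs : 1 < s.re) (S : Set (ℤ × ℤ))
    (hS : ∀ v, v ∈ S ↔ v ∈ primitivePairs ∧
      ∀ g : SL(2, ℤ), (g 1 0, g 1 1) = v → g ∈ Γ)
    (hΓ : ∀ g ∈ Γ, (g 1 0, g 1 1) ∈ S) (hneg : ∀ v ∈ S, -v ∈ S) :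
    2 * eisensteinSeries 𝔞 z s =
      ∑' v, S.indicator (fun v => (imForm z.re z.im v : ℂ) ^ s) v := by
  refine two_mul_eisensteinSeries 𝔞 z s (fun γ => ((γ : SL(2, ℤ)) 1 0, (γ : SL(2, ℤ)) 1 1)) S _
    (fun v hv => ((hS v).1 hv).1) (fun γ => hΓ γ γ.2) hneg ?_ ?_
    (fun γ => 𝔞.imAt_mk_of_scaling_one h' z γ) (imForm_neg _ _)
    (summable_imForm_cpow z.re z.im_pos hs)
  · intro v hv
    obtain ⟨h1, h2⟩ := (hS v).1 hv
    obtain ⟨g, hg⟩ := IsCoprime.exists_SL2_row h1 1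
    have hgv : (g 1 0, g 1 1) = v := Prod.ext hg.1 hg.2
    exact ⟨⟨g, h2 g hgv⟩, hgv⟩
  · intro γ γ'
    rw [𝔞.mem_stab_of_infty h, Subgroup.coe_mul, Subgroup.coe_inv, mul_entry_int]
    obtain ⟨h00, -, h10, -⟩ := inv_entries (γ : SL(2, ℤ))
    rw [h00, h10]
    constructor <;> intro h <;> linarith

theorem eisensteinSeries_full (z : ℍ) {s : ℂ} (hs : 1 < s.re) :
    2 * eisensteinSeries cuspFull z s =
      ∑' v, primitivePairs.indicator (fun v => (imForm z.re z.im v : ℂ) ^ s) v := by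
  refine two_mul_eisensteinSeries_infty cuspFull rfl rfl z hs primitivePairs ?_ ?_ ?_
  · intro v
    exact ⟨fun h => ⟨h, fun g _ => Subgroup.mem_top g⟩, fun h => h.1⟩
  · exact fun g _ => isCoprime_row g 1
  · intro v hv
    exact IsCoprime.neg_neg hv

theorem mem_Gamma0_iff (p : ℕ) (g : SL(2, ℤ)) :
    g ∈ CongruenceSubgroup.Gamma0 p ↔ (p : ℤ) ∣ g 1 0 := by
  rw [CongruenceSubgroup.Gamma0_mem, ZMod.intCast_zmod_eq_zero_iff_dvd]

theorem eisensteinSeries_cuspInfty (p : ℕ) (z : ℍ) {s : ℂ} (hs : 1 < s.re) :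
    2 * eisensteinSeries (cuspInfty p) z s =
      ∑' v, (primitivePairs ∩ {u | (p : ℤ) ∣ u.1}).indicator
        (fun v => (imForm z.re z.im v : ℂ) ^ s) v := by
  refine two_mul_eisensteinSeries_infty (cuspInfty p) rfl rfl z hs _ ?_ ?_ ?_
  · intro v
    constructor
    · rintro ⟨h1, h2⟩
      refine ⟨h1, fun g hg => (mem_Gamma0_iff p g).2 ?_⟩
      rw [← hg] at h2
      exact h2
    · rintro ⟨h1, h2⟩
      obtain ⟨g, hg⟩ := IsCoprime.exists_SL2_row h1 1
      refine ⟨h1, ?_⟩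
      have := (mem_Gamma0_iff p g).1 (h2 g (Prod.ext hg.1 hg.2))
      rw [hg.1] at this
      exact this
  · exact fun g hg => ⟨isCoprime_row g 1, (mem_Gamma0_iff p g).1 hg⟩
  · rintro v ⟨h1, h2⟩
    exact ⟨IsCoprime.neg_neg h1, (dvd_neg (a := (p : ℤ))).2 h2⟩

/-- For the stabilizer of `0` the top row `(a,b)` replaces the bottom row, and `p ∤ a` since the
determinant is `1` and `p ∣ c`. The bottom row of `τ_0⁻¹ γ` is `√p (a,b)`, which produces the factor
`p^(-s)`. -/
theorem eisensteinSeries_cuspZero {p : ℕ} (hp : p.Prime) (z : ℍ) {s : ℂ} (hs : 1 < s.re) :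
    2 * eisensteinSeries (cuspZero p hp.pos) z s = 1 / (p : ℂ) ^ s *
      ∑' v, (primitivePairs ∩ {u | ¬ (p : ℤ) ∣ u.1}).indicator
        (fun v => (imForm z.re z.im v : ℂ) ^ s) v := by
  have hp0 : (0 : ℝ) < p := by exact_mod_cast hp.pos
  have hpow : ∀ v, (((imForm z.re z.im v / p : ℝ)) : ℂ) ^ s =
      1 / (p : ℂ) ^ s * (imForm z.re z.im v : ℂ) ^ s := by
    intro v
    rw [div_eq_mul_inv, Complex.ofReal_mul, Complex.mul_cpow_ofReal_nonneg
      (imForm_nonneg _ z.im_pos v) (by positivity), mul_comm, Complex.ofReal_inv,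
      Complex.inv_cpow, one_div, Complex.ofReal_natCast]
    rw [Complex.arg_ofReal_of_nonneg hp0.le]
    exact Real.pi_pos.ne
  rw [two_mul_eisensteinSeries (cuspZero p hp.pos) z s
    (fun γ => ((γ : SL(2, ℤ)) 0 0, (γ : SL(2, ℤ)) 0 1))
    (primitivePairs ∩ {u | ¬ (p : ℤ) ∣ u.1}) (fun v => imForm z.re z.im v / p)
    Set.inter_subset_left, ← tsum_mul_left]
  · refine tsum_congr fun v => ?_
    by_cases hv : v ∈ primitivePairs ∩ {u | ¬ (p : ℤ) ∣ u.1}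
    · simp only [Set.indicator_of_mem hv, hpow]
    · simp only [Set.indicator_of_notMem hv, mul_zero]
  · intro γ
    refine ⟨isCoprime_row _ 0, fun h => ?_⟩
    have h1 := (mem_Gamma0_iff p _).1 γ.2
    have hdet := (γ : SL(2, ℤ)).det_coe
    rw [Matrix.det_fin_two] at hdet
    have h2 : (p : ℤ) ∣ 1 := by
      rw [← hdet]
      exact dvd_sub (dvd_mul_of_dvd_left h _) (dvd_mul_of_dvd_right h1 _)
    exact (Nat.prime_iff_prime_int.1 hp).not_dvd_one h2
  · rintro v ⟨h1, h2⟩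
    exact ⟨IsCoprime.neg_neg h1, fun h => h2 ((dvd_neg (a := (p : ℤ))).1 h)⟩
  · rintro v ⟨h1, h2⟩
    have h3 : IsCoprime v.1 (p : ℤ) :=
      ((Nat.prime_iff_prime_int.1 hp).coprime_iff_not_dvd.2 h2).symm
    -- Coprimality of `v.1` with `v.2 p`, and not just with `v.2`, makes the completing lower left
    -- entry `-(p b)` divisible by `p`.
    obtain ⟨a, b, hab⟩ := IsCoprime.mul_right h1 h3
    refine ⟨⟨⟨!![v.1, v.2; -(p * b), a], ?_⟩, ?_⟩, rfl⟩
    · rw [Matrix.det_fin_two_of]; linear_combination hab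
    · exact (mem_Gamma0_iff p _).2 ((dvd_neg (a := (p : ℤ))).2 (dvd_mul_right _ _))
  · intro γ γ'
    rw [(cuspZero p hp.pos).mem_stab_of_zero rfl, Subgroup.coe_mul, Subgroup.coe_inv,
      mul_entry_int]
    obtain ⟨-, h01, -, h11⟩ := inv_entries (γ : SL(2, ℤ))
    rw [h01, h11]
    constructor <;> intro h <;> linarith
  · intro γ
    rw [ScaledCusp.imAt_mk, im_smul_eq]
    have hsq : Real.sqrt p * Real.sqrt p = p := Real.mul_self_sqrt hp0.le
    have e10 : ((cuspZero p hp.pos).scaling⁻¹ : SL(2, ℝ)) 1 0 = Real.sqrt p := by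
      change ((tauZero p hp.pos)⁻¹ : SL(2, ℝ)) 1 0 = _
      rw [Matrix.SpecialLinearGroup.SL2_inv_expl]
      simp [tauZero]
    have e11 : ((cuspZero p hp.pos).scaling⁻¹ : SL(2, ℝ)) 1 1 = 0 := by
      change ((tauZero p hp.pos)⁻¹ : SL(2, ℝ)) 1 1 = _
      rw [Matrix.SpecialLinearGroup.SL2_inv_expl]
      simp [tauZero]
    rw [mul_entry, mul_entry, e10, e11]
    simp only [toReal_apply, imForm, zero_mul, add_zero]
    rw [div_div]
    congr 1
    linear_combination ((((γ : SL(2, ℤ)) 0 0 : ℤ) : ℝ) * z.re + (((γ : SL(2, ℤ)) 0 1 : ℤ) : ℝ)) ^ 2 * hsq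
      + ((((γ : SL(2, ℤ)) 0 0 : ℤ) : ℝ) * z.im) ^ 2 * hsq
  · intro v
    simp only [imForm_neg]
  · simp_rw [hpow]
    exact (summable_imForm_cpow z.re z.im_pos hs).mul_left _

/-! ### Poisson summation for the lattice sum -/

/-- A majorant for the Bessel terms of the Fourier expansion. -/
theorem exists_summable_bessel_bound (A : ℝ) {y₀ : ℝ} (hy₀ : 0 < y₀) :
    ∃ u : ℕ+ × ℕ+ → ℝ, Summable u ∧ ∀ (ν : ℂ) (y : ℝ) (w : ℕ+ × ℕ+), |ν.re| ≤ A → y₀ ≤ y →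
      ‖(((w.2 : ℕ) / (w.1 : ℕ) : ℝ) : ℂ) ^ ν *
        besselK ν (2 * Real.pi * (w.2 : ℕ) * (w.1 : ℕ) * y)‖ ≤ u w := by
  have hpi := Real.pi_pos
  obtain ⟨C, hC0, hC⟩ := exists_norm_besselK_le A (y₀ := 2 * Real.pi * y₀) (by positivity)
  obtain ⟨k, hk⟩ := exists_nat_ge A
  -- The decay available is `exp(-π m c y)`; as `c + m ≤ 2mc` for positive integers, half of `π y₀`
  -- can be given to each variable.
  set r : ℝ := Real.pi * y₀ / 2 with hr
  have hr0 : 0 < r := by positivity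
  set a : ℕ+ → ℝ := fun n => ((n : ℕ) : ℝ) ^ k * Real.exp (-r * (n : ℕ)) with ha
  have hsa : Summable a :=
    (Real.summable_pow_mul_exp_neg_nat_mul k hr0).comp_injective PNat.coe_injective
  have ha0 : 0 ≤ a := fun n => by rw [ha]; positivity
  refine ⟨fun w => C * (a w.1 * a w.2), (hsa.mul_of_nonneg hsa ha0 ha0).mul_left C, ?_⟩
  rintro ν y ⟨c, m⟩ hν hy
  have hc1 : (1 : ℝ) ≤ (c : ℕ) := by exact_mod_cast c.pos
  have hm1 : (1 : ℝ) ≤ (m : ℕ) := by exact_mod_cast m.pos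
  simp only [ha]
  generalize ((c : ℕ) : ℝ) = c' at hc1 ⊢
  generalize ((m : ℕ) : ℝ) = m' at hm1 ⊢
  have hc0 : 0 < c' := by linarith
  have hm0 : 0 < m' := by linarith
  have hmc : 1 ≤ m' * c' := one_le_mul_of_one_le_of_one_le hm1 hc1
  have hA0 : 0 ≤ A := (abs_nonneg _).trans hν
  rw [norm_mul, Complex.norm_cpow_eq_rpow_re_of_pos (by positivity)]
  have h1 : (m' / c') ^ ν.re ≤ (c' * m') ^ k := by
    have e1 : (m' / c') ^ ν.re ≤ (m' * c') ^ A := by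
      rcases le_total 1 (m' / c') with h | h
      · calc (m' / c') ^ ν.re ≤ (m' / c') ^ A :=
              Real.rpow_le_rpow_of_exponent_le h (le_trans (le_abs_self _) hν)
          _ ≤ (m' * c') ^ A := by
              apply Real.rpow_le_rpow (by positivity) _ hA0
              rw [div_le_iff₀ hc0]
              nlinarith [mul_le_mul_of_nonneg_left hc1 hm0.le, mul_nonneg hm0.le (sub_nonneg.2 hc1)]
      · calc (m' / c') ^ ν.re ≤ (m' / c') ^ (-A) :=
              Real.rpow_le_rpow_of_exponent_ge (by positivity) h
                (by linarith [neg_abs_le ν.re])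
          _ = (c' / m') ^ A := by rw [Real.rpow_neg (by positivity), ← Real.inv_rpow (by positivity), inv_div]
          _ ≤ (m' * c') ^ A := by
              apply Real.rpow_le_rpow (by positivity) _ hA0
              rw [div_le_iff₀ hm0]
              nlinarith [mul_le_mul_of_nonneg_left hm1 hc0.le, mul_nonneg hc0.le (sub_nonneg.2 hm1)]
    rw [mul_comm c' m']
    refine e1.trans ?_
    rw [← Real.rpow_natCast]
    exact Real.rpow_le_rpow_of_exponent_le hmc hk
  have h2 := hC ν (2 * Real.pi * m' * c' * y) hν (by
    have : y₀ ≤ m' * c' * y := by nlinarith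
    nlinarith)
  have h3 : Real.exp (-(2 * Real.pi * m' * c' * y / 2)) ≤
      Real.exp (-r * c') * Real.exp (-r * m') := by
    rw [← Real.exp_add]
    apply Real.exp_le_exp.2
    have e2 : c' + m' ≤ 2 * (m' * c') := by nlinarith
    have e3 : m' * c' * y₀ ≤ m' * c' * y := mul_le_mul_of_nonneg_left hy (by positivity)
    have e4 : r * (c' + m') ≤ Real.pi * (m' * c' * y) := by
      calc r * (c' + m') ≤ r * (2 * (m' * c')) := mul_le_mul_of_nonneg_left e2 hr0.le
        _ = Real.pi * (m' * c' * y₀) := by rw [hr]; ring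
        _ ≤ _ := mul_le_mul_of_nonneg_left e3 hpi.le
    linarith
  calc (m' / c') ^ ν.re * ‖besselK ν (2 * Real.pi * m' * c' * y)‖
      ≤ (c' * m') ^ k * (C * (Real.exp (-r * c') * Real.exp (-r * m'))) := by
        refine mul_le_mul h1 (h2.trans (mul_le_mul_of_nonneg_left h3 hC0)) (norm_nonneg _)
          (by positivity)
    _ = C * (c' ^ k * Real.exp (-r * c') * (m' ^ k * Real.exp (-r * m'))) := by
        rw [mul_pow]; ring

theorem integral_cpow_mul_exp_pos {s : ℂ} (hs : 0 < s.re) {a : ℝ} (ha : 0 < a) :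
    ∫ t in Set.Ioi (0 : ℝ), (t : ℂ) ^ (s - 1) * (Real.exp (-(Real.pi * a * t)) : ℂ) =
      (Real.pi : ℂ) ^ (-s) * Complex.Gamma s * ((1 / a : ℝ) : ℂ) ^ s := by
  have h := Complex.integral_cpow_mul_exp_neg_mul_Ioi hs (r := Real.pi * a) (by positivity)
  have e : ∀ t : ℝ, (t : ℂ) ^ (s - 1) * (Real.exp (-(Real.pi * a * t)) : ℂ) =
      (t : ℂ) ^ (s - 1) * Complex.exp (-(((Real.pi * a : ℝ) : ℂ) * t)) := by
    intro t; push_cast; rfl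
  simp_rw [e]
  rw [h]
  have h2 : (1 / ((Real.pi * a : ℝ) : ℂ)) ^ s = (Real.pi : ℂ) ^ (-s) * ((1 / a : ℝ) : ℂ) ^ s := by
    have : (1 / ((Real.pi * a : ℝ) : ℂ)) = ((1 / Real.pi : ℝ) : ℂ) * ((1 / a : ℝ) : ℂ) := by
      push_cast; field_simp
    rw [this, Complex.mul_cpow_ofReal_nonneg (by positivity) (by positivity), one_div,
      Complex.ofReal_inv, Complex.inv_cpow, Complex.cpow_neg]
    rw [Complex.arg_ofReal_of_nonneg Real.pi_pos.le]
    exact Real.pi_pos.ne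
  rw [h2]; ring

theorem norm_cpow_mul_ofReal {t : ℝ} (ht : 0 < t) (s : ℂ) {b : ℝ} (hb : 0 ≤ b) :
    ‖(t : ℂ) ^ (s - 1) * (b : ℂ)‖ = t ^ (s.re - 1) * b := by
  rw [norm_mul, Complex.norm_cpow_eq_rpow_re_of_pos ht, Complex.norm_real, Real.norm_of_nonneg hb]
  simp

/-- The Mellin transform of a shifted theta series. -/
theorem hasSum_evenKernel_mellin (α : ℝ) {β : ℝ} (hβ : 0 < β) {s : ℂ} (hs : 0 < s.re)
    (hsum : Summable fun d : ℤ => (1 / ((α + d) ^ 2 + β ^ 2)) ^ s.re) :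
    HasSum (fun d : ℤ => (Real.pi : ℂ) ^ (-s) * Complex.Gamma s *
      ((1 / ((α + d) ^ 2 + β ^ 2) : ℝ) : ℂ) ^ s)
      (∫ t in Set.Ioi (0 : ℝ), (t : ℂ) ^ (s - 1) *
        (Real.exp (-(Real.pi * β ^ 2 * t)) * HurwitzZeta.evenKernel α t : ℝ)) := by
  set F : ℤ → ℝ → ℂ := fun d t => (t : ℂ) ^ (s - 1) *
    (Real.exp (-(Real.pi * ((α + d) ^ 2 + β ^ 2) * t)) : ℂ) with hF
  have hpos : ∀ d : ℤ, 0 < (α + d) ^ 2 + β ^ 2 := fun d => by positivity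
  have hval : ∀ d, ∫ t in Set.Ioi (0 : ℝ), F d t = (Real.pi : ℂ) ^ (-s) * Complex.Gamma s *
      ((1 / ((α + d) ^ 2 + β ^ 2) : ℝ) : ℂ) ^ s := fun d => integral_cpow_mul_exp_pos hs (hpos d)
  have hint : ∀ d, Integrable (F d) (volume.restrict (Set.Ioi 0)) := by
    intro d
    -- The Bochner integral of a non-integrable function is `0`, so the nonzero value already
    -- computed proves integrability.
    apply Integrable.of_integral_ne_zero
    rw [hval]
    refine mul_ne_zero (mul_ne_zero ?_ (Complex.Gamma_ne_zero_of_re_pos hs)) ?_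
    · simp [Complex.cpow_eq_zero_iff, Real.pi_ne_zero]
    · have := (hpos d).ne'
      rw [Ne, Complex.cpow_eq_zero_iff, not_and_or]
      left
      rw [Complex.ofReal_eq_zero]
      exact (one_div_pos.2 (hpos d)).ne'
  have hnorm : ∀ d, ∫ t in Set.Ioi (0 : ℝ), ‖F d t‖ =
      (1 / ((α + d) ^ 2 + β ^ 2)) ^ s.re * ((1 / Real.pi) ^ s.re * Real.Gamma s.re) := by
    intro d
    rw [← mul_assoc, ← Real.mul_rpow (one_div_pos.2 (hpos d)).le (by positivity), one_div_mul_one_div_rev,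
      ← Real.integral_rpow_mul_exp_neg_mul_Ioi hs (mul_pos Real.pi_pos (hpos d))]
    refine setIntegral_congr_fun measurableSet_Ioi fun t ht => ?_
    exact norm_cpow_mul_ofReal ht s (Real.exp_nonneg _)
  have key := hasSum_integral_of_summable_integral_norm hint (by
    simp_rw [hnorm]; exact hsum.mul_right _)
  simp_rw [hval] at key
  have hI : (∫ t in Set.Ioi (0 : ℝ), (t : ℂ) ^ (s - 1) *
      ((Real.exp (-(Real.pi * β ^ 2 * t)) * HurwitzZeta.evenKernel α t : ℝ) : ℂ)) =
      ∫ t in Set.Ioi (0 : ℝ), ∑' d, F d t := ?_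
  · rw [hI]
    exact key
  refine setIntegral_congr_fun measurableSet_Ioi fun t ht => ?_
  have ht : 0 < t := ht
  have h1 := (HurwitzZeta.hasSum_int_evenKernel α ht).tsum_eq
  simp only [hF]
  rw [tsum_mul_left, ← h1, ← tsum_mul_left, Complex.ofReal_tsum]
  congr 1
  refine tsum_congr fun d => ?_
  congr 1
  rw [← Real.exp_add]
  congr 1
  ring

/-- The coefficients of the cosine expansion of `cosKernel`. -/
noncomputable def cosCoeff (α : ℝ) (m : ℕ) : ℝ := if m = 0 then 1 else 2 * Real.cos (2 * Real.pi * m * α)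

theorem abs_cosCoeff_le (α : ℝ) (m : ℕ) : |cosCoeff α m| ≤ 2 := by
  unfold cosCoeff
  split_ifs
  · norm_num
  · rw [abs_mul, abs_two]
    linarith [Real.abs_cos_le_one (2 * Real.pi * m * α)]

theorem hasSum_cosCoeff (α : ℝ) {t : ℝ} (ht : 0 < t) :
    HasSum (fun m : ℕ => cosCoeff α m * Real.exp (-(Real.pi * m ^ 2 * t)))
      (HurwitzZeta.cosKernel α t) := by
  rw [← hasSum_nat_add_iff' 1]
  have h := HurwitzZeta.hasSum_nat_cosKernel₀ α ht
  have h1 : (fun n : ℕ => cosCoeff α (n + 1) * Real.exp (-(Real.pi * (n + 1 : ℕ) ^ 2 * t))) =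
      fun n : ℕ => 2 * Real.cos (2 * Real.pi * α * (n + 1)) *
        Real.exp (-Real.pi * (n + 1) ^ 2 * t) := by
    funext n
    simp only [cosCoeff, Nat.add_eq_zero_iff, one_ne_zero, and_false, if_false]
    push_cast
    congr 3 <;> ring
  rw [h1]
  simpa [cosCoeff] using h

theorem integral_bessel_pos (ν : ℂ) {β : ℝ} (hβ : 0 < β) {m : ℕ} (hm : 0 < m) :
    ∫ t in Set.Ioi (0 : ℝ), (t : ℂ) ^ (ν - 1) *
      (Real.exp (-(Real.pi * β ^ 2 * t) + -(Real.pi * m ^ 2 * (1 / t))) : ℂ) =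
      ((m / β : ℝ) : ℂ) ^ ν * (2 * besselK ν (2 * Real.pi * m * β)) := by
  have hm0 : (0 : ℝ) < m := by exact_mod_cast hm
  rw [← integral_cpow_mul_exp_eq_besselK ν (2 * Real.pi * m * β) (div_pos hm0 hβ)]
  refine setIntegral_congr_fun measurableSet_Ioi fun t ht => ?_
  have ht : 0 < t := ht
  congr 3
  field_simp
  ring

/-- Poisson summation for a row of the lattice. -/
theorem poisson_row (α : ℝ) {β : ℝ} (hβ : 0 < β) {s : ℂ} (hs : 1 / 2 < s.re)
    (hsum : Summable fun d : ℤ => (1 / ((α + d) ^ 2 + β ^ 2)) ^ s.re) :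
    (Real.pi : ℂ) ^ (-s) * Complex.Gamma s *
      ∑' d : ℤ, ((1 / ((α + d) ^ 2 + β ^ 2) : ℝ) : ℂ) ^ s =
    (Real.pi : ℂ) ^ (-(s - 1 / 2)) * Complex.Gamma (s - 1 / 2) *
        ((1 / β ^ 2 : ℝ) : ℂ) ^ (s - 1 / 2) +
      ∑' m : ℕ+, ((((m : ℕ) / β : ℝ) : ℂ) ^ (s - 1 / 2) *
        besselK (s - 1 / 2) (2 * Real.pi * (m : ℕ) * β)) *
          (4 * Real.cos (2 * Real.pi * (m : ℕ) * α) : ℝ) := by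
  set ν : ℂ := s - 1 / 2 with hν
  have hν0 : 0 < ν.re := by simp [hν]; linarith
  rw [← tsum_mul_left, (hasSum_evenKernel_mellin α hβ (by linarith) hsum).tsum_eq]
  set F : ℕ → ℝ → ℂ := fun m t => (t : ℂ) ^ (ν - 1) *
    ((Real.exp (-(Real.pi * β ^ 2 * t) + -(Real.pi * m ^ 2 * (1 / t))) : ℝ) : ℂ) with hF
  have hval0 : ∫ t in Set.Ioi (0 : ℝ), F 0 t = (Real.pi : ℂ) ^ (-ν) * Complex.Gamma ν *
      ((1 / β ^ 2 : ℝ) : ℂ) ^ ν := by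
    rw [← integral_cpow_mul_exp_pos hν0 (by positivity)]
    simp [hF]
  have hval : ∀ m : ℕ, 0 < m → ∫ t in Set.Ioi (0 : ℝ), F m t =
      ((m / β : ℝ) : ℂ) ^ ν * (2 * besselK ν (2 * Real.pi * m * β)) :=
    fun m hm => integral_bessel_pos ν hβ hm
  have hF0 : Integrable (F 0) (volume.restrict (Set.Ioi 0)) := by
    apply Integrable.of_integral_ne_zero
    rw [hval0]
    refine mul_ne_zero (mul_ne_zero ?_ (Complex.Gamma_ne_zero_of_re_pos hν0)) ?_
    · simp [Complex.cpow_eq_zero_iff, Real.pi_ne_zero]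
    · rw [Ne, Complex.cpow_eq_zero_iff, not_and_or]
      left
      rw [Complex.ofReal_eq_zero]
      positivity
  have hFmeas : ∀ m, AEStronglyMeasurable (F m) (volume.restrict (Set.Ioi 0)) := by
    intro m
    refine ContinuousOn.aestronglyMeasurable ?_ measurableSet_Ioi
    have h0 : ∀ t ∈ Set.Ioi (0 : ℝ), t ≠ 0 := fun t ht => ne_of_gt ht
    have h1 : ContinuousOn (fun t : ℝ => (t : ℂ) ^ (ν - 1)) (Set.Ioi 0) := fun t ht =>
      (Complex.continuousAt_ofReal_cpow_const t _ (Or.inr (h0 t ht))).continuousWithinAt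
    refine h1.mul (Complex.continuous_ofReal.comp_continuousOn ?_)
    fun_prop (disch := assumption)
  -- The extra factor `exp(-πm²/t)` is at most `1`, so `F 0` dominates.
  have hFint : ∀ m, Integrable (F m) (volume.restrict (Set.Ioi 0)) := by
    intro m
    refine hF0.mono (hFmeas m) ?_
    rw [ae_restrict_iff' measurableSet_Ioi]
    refine Filter.Eventually.of_forall fun t ht => ?_
    have ht : 0 < t := ht
    simp only [hF]
    rw [norm_cpow_mul_ofReal ht _ (Real.exp_nonneg _), norm_cpow_mul_ofReal ht _ (Real.exp_nonneg _)]
    refine mul_le_mul_of_nonneg_left (Real.exp_le_exp.2 ?_) (by positivity)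
    have : 0 ≤ Real.pi * m ^ 2 * (1 / t) := by positivity
    simpa using this
  -- Taking norms replaces `ν` by its real part, so the `L¹` norms are Bessel values again and the
  -- same majorant sums them.
  have hnorm : ∀ m : ℕ, 0 < m → ∫ t in Set.Ioi (0 : ℝ), ‖F m t‖ =
      ‖((m / β : ℝ) : ℂ) ^ (ν.re : ℂ) * (2 * besselK ν.re (2 * Real.pi * m * β))‖ := by
    intro m hm
    rw [← integral_bessel_pos (ν.re : ℂ) hβ hm]
    have : ∀ t ∈ Set.Ioi (0 : ℝ), (t : ℂ) ^ ((ν.re : ℂ) - 1) *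
        ((Real.exp (-(Real.pi * β ^ 2 * t) + -(Real.pi * m ^ 2 * (1 / t))) : ℝ) : ℂ) =
        ((‖F m t‖ : ℝ) : ℂ) := by
      intro t ht
      have ht : 0 < t := ht
      simp only [hF]
      rw [norm_cpow_mul_ofReal ht _ (Real.exp_nonneg _), Complex.ofReal_mul, Complex.ofReal_cpow ht.le]
      push_cast
      rfl
    rw [setIntegral_congr_fun measurableSet_Ioi this, integral_complex_ofReal, Complex.norm_real,
      Real.norm_of_nonneg (integral_nonneg fun t => norm_nonneg _)]
  obtain ⟨u, hu, hub⟩ := exists_summable_bessel_bound |ν.re| hβ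
  have hu1 : Summable fun m : ℕ+ => u (1, m) :=
    hu.comp_injective (fun a b h => (Prod.ext_iff.1 h).2)
  have hnormsum : Summable fun m : ℕ => ∫ t in Set.Ioi (0 : ℝ), ‖F m t‖ := by
    rw [← summable_nat_add_iff 1]
    have h2 : Summable fun m : ℕ+ => ∫ t in Set.Ioi (0 : ℝ), ‖F m t‖ := by
      refine Summable.of_nonneg_of_le (fun m => integral_nonneg fun t => norm_nonneg _) (fun m => ?_)
        (hu1.mul_left (‖((1 / β : ℝ) : ℂ) ^ (ν.re : ℂ)‖ * 2))
      have h3 := hub ν.re β (1, m) (by simp) le_rfl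
      simp only [PNat.one_coe, Nat.cast_one, div_one, mul_one] at h3
      rw [hnorm m m.pos]
      have h4 : ((((m : ℕ) : ℝ) / β : ℝ) : ℂ) ^ (ν.re : ℂ) =
          ((1 / β : ℝ) : ℂ) ^ (ν.re : ℂ) * ((((m : ℕ) : ℝ)) : ℂ) ^ (ν.re : ℂ) := by
        rw [← Complex.mul_cpow_ofReal_nonneg (by positivity) (by positivity), ← Complex.ofReal_mul,
          one_div_mul_eq_div]
      rw [h4]
      calc _ = ‖((1 / β : ℝ) : ℂ) ^ (ν.re : ℂ)‖ * 2 * ‖((((m : ℕ) : ℝ)) : ℂ) ^ (ν.re : ℂ) *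
            besselK ν.re (2 * Real.pi * (m : ℕ) * β)‖ := by
            simp only [norm_mul, Complex.norm_ofNat]; ring
        _ ≤ _ := mul_le_mul_of_nonneg_left h3 (by positivity)
    exact (summable_pnat_iff_summable_succ (f := fun m : ℕ => ∫ t in Set.Ioi (0 : ℝ), ‖F m t‖)).1 h2
  have key := hasSum_integral_of_summable_integral_norm
    (F := fun m t => F m t * (cosCoeff α m : ℂ)) (μ := volume.restrict (Set.Ioi 0))
    (fun m => (hFint m).mul_const _) (by
      refine Summable.of_nonneg_of_le (fun m => integral_nonneg fun t => norm_nonneg _) (fun m => ?_)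
        (hnormsum.mul_right 2)
      simp only [norm_mul, Complex.norm_real]
      rw [integral_mul_const]
      exact mul_le_mul_of_nonneg_left (abs_cosCoeff_le α m)
        (integral_nonneg fun t => norm_nonneg _))
  have hL : (∫ t in Set.Ioi (0 : ℝ), (t : ℂ) ^ (s - 1) *
      ((Real.exp (-(Real.pi * β ^ 2 * t)) * HurwitzZeta.evenKernel α t : ℝ) : ℂ)) =
      ∫ t in Set.Ioi (0 : ℝ), ∑' m, F m t * (cosCoeff α m : ℂ) := by
    refine setIntegral_congr_fun measurableSet_Ioi fun t ht => ?_
    have ht : 0 < t := ht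
    have h1 := (hasSum_cosCoeff α (one_div_pos.2 ht)).tsum_eq
    simp only [hF]
    -- This is the Poisson summation. Its factor `t^(-1/2)` shifts `s` to `ν = s - 1/2`.
    rw [HurwitzZeta.evenKernel_functional_equation, ← h1]
    have h2 : ∀ m : ℕ, (t : ℂ) ^ (ν - 1) *
        ((Real.exp (-(Real.pi * β ^ 2 * t) + -(Real.pi * m ^ 2 * (1 / t))) : ℝ) : ℂ) *
        (cosCoeff α m : ℂ) = ((t : ℂ) ^ (ν - 1) * (Real.exp (-(Real.pi * β ^ 2 * t)) : ℝ)) *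
        ((cosCoeff α m * Real.exp (-(Real.pi * m ^ 2 * (1 / t))) : ℝ) : ℂ) := by
      intro m
      rw [Real.exp_add]
      push_cast
      ring
    simp_rw [h2]
    rw [tsum_mul_left, ← Complex.ofReal_tsum]
    have h3 : (t : ℂ) ^ (s - 1) * ((1 / t ^ (1 / 2 : ℝ) : ℝ) : ℂ) = (t : ℂ) ^ (ν - 1) := by
      have ht' : (t : ℂ) ≠ 0 := Complex.ofReal_ne_zero.2 ht.ne'
      rw [one_div, ← Real.rpow_neg ht.le, Complex.ofReal_cpow ht.le, ← Complex.cpow_add _ _ ht']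
      congr 1
      rw [hν]; push_cast; ring
    rw [← h3]
    push_cast
    ring
  -- The frequency `0` gives a Gamma integral and the others give Bessel functions.
  rw [hL, ← key.tsum_eq, key.summable.tsum_eq_zero_add]
  congr 1
  · simp only [cosCoeff, if_true, Complex.ofReal_one, mul_one]
    exact hval0
  · rw [← tsum_pnat_eq_tsum_succ
      (f := fun m : ℕ => ∫ t in Set.Ioi (0 : ℝ), F m t * (cosCoeff α m : ℂ))]
    refine tsum_congr fun m => ?_
    rw [integral_mul_const, hval m m.pos, cosCoeff, if_neg m.ne_zero]
    push_cast
    ring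

/-! ### The nonconstant part of the Fourier expansion -/

/-- A term of the nonconstant part of the Fourier expansion of the completed Eisenstein series,
without the factor depending on the real part. -/
noncomputable def besselTerm (y : ℝ) (s : ℂ) (w : ℕ+ × ℕ+) : ℂ :=
  (((w.2 : ℕ) / (w.1 : ℕ) : ℝ) : ℂ) ^ (s - 1 / 2) *
    besselK (s - 1 / 2) (2 * Real.pi * (w.2 : ℕ) * (w.1 : ℕ) * y)

/-- The nonconstant part of the Fourier expansion of the completed Eisenstein series. -/
noncomputable def besselSum (x y : ℝ) (s : ℂ) : ℂ :=
  ∑' w : ℕ+ × ℕ+, besselTerm y s w *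
    (4 * Real.sqrt y * Real.cos (2 * Real.pi * ((w.2 : ℕ) * (w.1 : ℕ)) * x) : ℝ)

theorem abs_four_sqrt_mul_cos_le (y t : ℝ) :
    |4 * Real.sqrt y * Real.cos t| ≤ 4 * Real.sqrt y := by
  rw [abs_mul, abs_of_nonneg (by positivity : 0 ≤ 4 * Real.sqrt y)]
  exact mul_le_of_le_one_right (by positivity) (Real.abs_cos_le_one _)

theorem summable_besselTerm {y : ℝ} (hy : 0 < y) (s : ℂ) : Summable fun w => ‖besselTerm y s w‖ := by
  obtain ⟨u, hu, hb⟩ := exists_summable_bessel_bound |(s - 1 / 2).re| hy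
  exact Summable.of_nonneg_of_le (fun w => norm_nonneg _) (fun w => hb _ y w le_rfl le_rfl) hu

theorem norm_besselSum_term_le (y : ℝ) (s : ℂ) (w : ℕ+ × ℕ+) (t : ℝ) :
    ‖besselTerm y s w * (4 * Real.sqrt y * Real.cos t : ℝ)‖ ≤
      ‖besselTerm y s w‖ * (4 * Real.sqrt y) := by
  rw [norm_mul, Complex.norm_real]
  exact mul_le_mul_of_nonneg_left (abs_four_sqrt_mul_cos_le y t) (norm_nonneg _)

theorem summable_besselSum_term (x : ℝ) {y : ℝ} (hy : 0 < y) (s : ℂ) :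
    Summable fun w : ℕ+ × ℕ+ => besselTerm y s w *
      (4 * Real.sqrt y * Real.cos (2 * Real.pi * ((w.2 : ℕ) * (w.1 : ℕ)) * x) : ℝ) :=
  Summable.of_norm_bounded ((summable_besselTerm hy s).mul_right (4 * Real.sqrt y))
    fun w => norm_besselSum_term_le y s w _

theorem continuous_besselSum {y : ℝ} (hy : 0 < y) (s : ℂ) :
    Continuous fun x => besselSum x y s := by
  refine continuous_tsum (fun w => ?_) ((summable_besselTerm hy s).mul_right (4 * Real.sqrt y))
    fun w x => norm_besselSum_term_le y s w _
  fun_prop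

/-- The majorant is uniform on vertical strips, so the entire terms sum locally uniformly. No
restriction on `s` remains, which is what yields the continuation. -/
theorem differentiable_besselSum (x : ℝ) {y : ℝ} (hy : 0 < y) :
    Differentiable ℂ fun s => besselSum x y s := by
  intro s₀
  set A : ℝ := |(s₀ - 1 / 2).re| + 1 with hA
  set U : Set ℂ := {s | |(s - 1 / 2).re| < A} with hU
  have hUo : IsOpen U := isOpen_lt (by fun_prop) continuous_const
  obtain ⟨u, hu, hb⟩ := exists_summable_bessel_bound A hy
  have h : DifferentiableOn ℂ (fun s => besselSum x y s) U := by
    refine Complex.differentiableOn_tsum_of_summable_norm (hu.mul_right (4 * Real.sqrt y))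
      (fun w => ?_) hUo (fun w s hs => ?_)
    · have hw : ((((w.2 : ℕ) : ℝ) / ((w.1 : ℕ) : ℝ) : ℝ) : ℂ) ≠ 0 := by
        have h1 := w.1.pos
        have h2 := w.2.pos
        rw [Complex.ofReal_ne_zero]
        positivity
      have hy' : 0 < 2 * Real.pi * (w.2 : ℕ) * (w.1 : ℕ) * y := by
        have h1 := w.1.pos
        have h2 := w.2.pos
        positivity
      have hK : Differentiable ℂ fun s : ℂ =>
          besselK (s - 1 / 2) (2 * Real.pi * (w.2 : ℕ) * (w.1 : ℕ) * y) :=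
        (differentiable_besselK hy').comp (differentiable_id.sub_const _)
      have hP : Differentiable ℂ fun s : ℂ =>
          ((((w.2 : ℕ) : ℝ) / ((w.1 : ℕ) : ℝ) : ℝ) : ℂ) ^ (s - 1 / 2) := fun s =>
        (differentiableAt_id.sub_const _).const_cpow (Or.inl hw)
      exact ((hP.mul hK).mul_const _).differentiableOn
    · exact (norm_besselSum_term_le y s w _).trans
        (mul_le_mul_of_nonneg_right (hb _ y w (le_of_lt hs) le_rfl) (by positivity))
  exact h.differentiableAt (hUo.mem_nhds (by simp [hU, hA]))

/-! ### Termwise integration and the divisor sum -/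

theorem integral_exp_two_pi_int (j : ℤ) :
    ∫ x in (0 : ℝ)..1, Complex.exp (2 * Real.pi * Complex.I * j * x) = if j = 0 then 1 else 0 := by
  split_ifs with h
  · simp [h]
  · have hc : 2 * Real.pi * Complex.I * j ≠ 0 := by
      simp [Real.pi_ne_zero, h]
    rw [integral_exp_mul_complex hc]
    have : Complex.exp (2 * Real.pi * Complex.I * j * (1 : ℝ)) = 1 := by
      rw [← Complex.exp_int_mul_two_pi_mul_I j]
      congr 1
      push_cast
      ring
    rw [this]
    simp

/-- The cosine carries the frequencies `k` and `-k`; as `k > 0` they differ, and at most one of them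
equals `n`. -/
theorem integral_cos_mul_exp (k : ℕ) (hk : 0 < k) (n : ℤ) :
    ∫ x in (0 : ℝ)..1, ((2 * Real.cos (2 * Real.pi * k * x) : ℝ) : ℂ) *
      Complex.exp (-(2 * Real.pi * Complex.I * n * x)) = if k = n.natAbs then 1 else 0 := by
  have e : ∀ x : ℝ, ((2 * Real.cos (2 * Real.pi * k * x) : ℝ) : ℂ) *
      Complex.exp (-(2 * Real.pi * Complex.I * n * x)) =
      Complex.exp (2 * Real.pi * Complex.I * ((k - n : ℤ) : ℂ) * x) +
      Complex.exp (2 * Real.pi * Complex.I * ((-k - n : ℤ) : ℂ) * x) := by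
    intro x
    rw [Complex.ofReal_mul, Complex.ofReal_cos, Complex.ofReal_ofNat, Complex.two_cos, add_mul,
      ← Complex.exp_add, ← Complex.exp_add]
    congr 2 <;> push_cast <;> ring
  simp_rw [e]
  rw [intervalIntegral.integral_add, integral_exp_two_pi_int, integral_exp_two_pi_int]
  · rcases le_or_gt 0 n with h | h
    · have h1 : (-(k : ℤ) - n = 0) = False := by simp; omega
      have h2 : ((k : ℤ) - n = 0) = (k = n.natAbs) := propext ⟨by omega, by omega⟩
      simp [h1, h2]
    · have h1 : ((k : ℤ) - n = 0) = False := by simp; omega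
      have h2 : (-(k : ℤ) - n = 0) = (k = n.natAbs) := propext ⟨by omega, by omega⟩
      simp [h1, h2]
  · exact Continuous.intervalIntegrable (by fun_prop) _ _
  · exact Continuous.intervalIntegrable (by fun_prop) _ _

theorem tsum_pnat_prod_eq_divisorTau (ν : ℂ) {N : ℤ} (hN : N ≠ 0) :
    ∑' w : ℕ+ × ℕ+, (if (w.2 : ℕ) * (w.1 : ℕ) = N.natAbs then
      (((w.2 : ℕ) / (w.1 : ℕ) : ℝ) : ℂ) ^ ν else 0) = divisorTau ν N := by
  set f : ℕ × ℕ → ℂ := fun d => if d.1 * d.2 = N.natAbs then ((d.1 : ℂ) / (d.2 : ℂ)) ^ ν else 0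
    with hf
  -- The coordinates are swapped: the frequency `w.2` is the numerator `a` and the row `w.1` the
  -- denominator `b`.
  set φ : ℕ+ × ℕ+ → ℕ × ℕ := fun w => (w.2, w.1) with hφ
  have hinj : Function.Injective φ := by
    rintro ⟨a, b⟩ ⟨c, d⟩ h
    simp only [hφ, Prod.mk.injEq] at h
    exact Prod.ext (PNat.coe_injective h.2) (PNat.coe_injective h.1)
  have hN' : 0 < N.natAbs := Int.natAbs_pos.2 hN
  have hrange : Function.support f ⊆ Set.range φ := by
    intro d hd
    have h1 : d.1 * d.2 = N.natAbs := by
      by_contra h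
      exact hd (by simp [hf, h])
    have h2 : 0 < d.1 * d.2 := h1 ▸ hN'
    exact ⟨(⟨d.2, Nat.pos_of_mul_pos_left h2⟩, ⟨d.1, Nat.pos_of_mul_pos_right h2⟩), rfl⟩
  have h := hinj.tsum_eq hrange
  have h3 : ∀ w : ℕ+ × ℕ+, (if (w.2 : ℕ) * (w.1 : ℕ) = N.natAbs then
      (((w.2 : ℕ) / (w.1 : ℕ) : ℝ) : ℂ) ^ ν else 0) = f (φ w) := by
    intro w
    simp [hf, hφ]
  simp_rw [h3]
  rw [h, tsum_eq_sum (s := N.natAbs.divisorsAntidiagonal), divisorTau]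
  · refine Finset.sum_congr rfl fun d hd => ?_
    simp [hf, (Nat.mem_divisorsAntidiagonal.1 hd).1]
  · intro d hd
    rw [Nat.mem_divisorsAntidiagonal, not_and_or] at hd
    have : d.1 * d.2 ≠ N.natAbs := hd.resolve_right (by simpa using hN)
    simp [hf, this]

/-- The Fourier coefficients of `x ↦ besselSum (q x) y s`. -/
theorem integral_besselSum {q : ℕ} (hq : 0 < q) {y : ℝ} (hy : 0 < y) (s : ℂ) {n : ℤ} (hn : n ≠ 0) :
    ∫ x in (0 : ℝ)..1, besselSum (q * x) y s * Complex.exp (-(2 * Real.pi * Complex.I * n * x)) =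
      if (q : ℤ) ∣ n then divisorTau (s - 1 / 2) (n / q) * (2 * Real.sqrt y *
        besselK (s - 1 / 2) (2 * Real.pi * |((n / q : ℤ) : ℝ)| * y)) else 0 := by
  set F : ℕ+ × ℕ+ → ℝ → ℂ := fun w x => besselTerm y s w *
    (4 * Real.sqrt y * Real.cos (2 * Real.pi * ((w.2 : ℕ) * (w.1 : ℕ)) * (q * x)) : ℝ) *
    Complex.exp (-(2 * Real.pi * Complex.I * n * x)) with hF
  have hFc : ∀ w, Continuous (F w) := by
    intro w; simp only [hF]; fun_prop
  have hFn : ∀ w x, ‖F w x‖ ≤ ‖besselTerm y s w‖ * (4 * Real.sqrt y) := by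
    intro w x
    have h1 : ‖Complex.exp (-(2 * Real.pi * Complex.I * n * x))‖ = 1 := by
      rw [Complex.norm_exp]; simp
    simp only [hF]
    rw [norm_mul, h1, mul_one]
    exact norm_besselSum_term_le y s w _
  have hFi : ∀ w, Integrable (F w) (volume.restrict (Set.Ioc 0 1)) := fun w =>
    ((hFc w).integrableOn_Icc (a := 0) (b := 1)).mono_set Set.Ioc_subset_Icc_self
  have key := hasSum_integral_of_summable_integral_norm hFi (by
    refine Summable.of_nonneg_of_le (fun w => integral_nonneg fun x => norm_nonneg _) (fun w => ?_)
      ((summable_besselTerm hy s).mul_right (4 * Real.sqrt y))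
    calc ∫ x in Set.Ioc (0 : ℝ) 1, ‖F w x‖
        ≤ ∫ _ in Set.Ioc (0 : ℝ) 1, ‖besselTerm y s w‖ * (4 * Real.sqrt y) :=
          integral_mono (hFi w).norm (integrable_const _) (hFn w)
      _ = _ := by simp)
  have hval : ∀ w, ∫ x in Set.Ioc (0 : ℝ) 1, F w x = 2 * Real.sqrt y * (besselTerm y s w *
      (if (w.2 : ℕ) * (w.1 : ℕ) * q = n.natAbs then 1 else 0)) := by
    intro w
    rw [← intervalIntegral.integral_of_le zero_le_one,
      ← integral_cos_mul_exp _ (by have := w.1.pos; have := w.2.pos; positivity),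
      ← mul_assoc, ← intervalIntegral.integral_const_mul]
    congr 1
    funext x
    simp only [hF]
    push_cast
    ring_nf
  rw [intervalIntegral.integral_of_le zero_le_one]
  have hsum : ∀ x : ℝ, besselSum (q * x) y s * Complex.exp (-(2 * Real.pi * Complex.I * n * x)) =
      ∑' w, F w x := by
    intro x
    rw [besselSum, ← tsum_mul_right]
  simp_rw [hsum]
  rw [← key.tsum_eq]
  simp_rw [hval]
  rw [tsum_mul_left]
  split_ifs with hdvd
  · obtain ⟨N, rfl⟩ := hdvd
    have hq0 : (q : ℤ) ≠ 0 := by exact_mod_cast hq.ne'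
    have hN : N ≠ 0 := right_ne_zero_of_mul hn
    rw [Int.mul_ediv_cancel_left _ hq0, ← tsum_pnat_prod_eq_divisorTau _ hN]
    have h1 : ∀ w : ℕ+ × ℕ+, besselTerm y s w *
        (if (w.2 : ℕ) * (w.1 : ℕ) * q = ((q : ℤ) * N).natAbs then 1 else 0) =
        (if (w.2 : ℕ) * (w.1 : ℕ) = N.natAbs then
          (((w.2 : ℕ) / (w.1 : ℕ) : ℝ) : ℂ) ^ (s - 1 / 2) else 0) *
        besselK (s - 1 / 2) (2 * Real.pi * |(N : ℝ)| * y) := by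
      intro w
      have h2 : ((w.2 : ℕ) * (w.1 : ℕ) * q = ((q : ℤ) * N).natAbs) ↔
          (w.2 : ℕ) * (w.1 : ℕ) = N.natAbs := by
        rw [Int.natAbs_mul, Int.natAbs_natCast, mul_comm q]
        exact Nat.mul_left_inj hq.ne'
      simp only [h2]
      split_ifs with h3
      · have h4 : |(N : ℝ)| = (w.2 : ℕ) * (w.1 : ℕ) := by
          rw [← Int.cast_abs, Int.abs_eq_natAbs, ← h3]; push_cast; rfl
        rw [besselTerm, h4, mul_one, ← mul_assoc (2 * Real.pi)]
      · simp
    simp_rw [h1]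
    rw [tsum_mul_right]
    ring
  · have h1 : ∀ w : ℕ+ × ℕ+, besselTerm y s w *
        (if (w.2 : ℕ) * (w.1 : ℕ) * q = n.natAbs then 1 else 0) = 0 := by
      intro w
      rw [if_neg, mul_zero]
      intro h
      exact hdvd (Int.natCast_dvd.2 ⟨_, h.symm.trans (mul_comm _ _)⟩)
    simp_rw [h1]
    simp

/-! ### The Fourier expansion of the lattice sum -/

theorem imForm_eq_mul (x y : ℝ) (c d : ℤ) :
    imForm x y (c, d) = y * (1 / ((c * x + d) ^ 2 + (c * y) ^ 2)) := by
  rw [mul_one_div]; rfl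

theorem imForm_row_cpow (x : ℝ) {y : ℝ} (hy : 0 < y) (s : ℂ) (c d : ℤ) :
    (imForm x y (c, d) : ℂ) ^ s =
      (y : ℂ) ^ s * ((1 / ((c * x + d) ^ 2 + (c * y) ^ 2) : ℝ) : ℂ) ^ s := by
  rw [imForm_eq_mul, Complex.ofReal_mul, Complex.mul_cpow_ofReal_nonneg hy.le (by positivity)]

theorem tsum_imForm_zero (x : ℝ) {y : ℝ} (hy : 0 < y) {s : ℂ} (hs : 1 < s.re) :
    ∑' d : ℤ, (imForm x y (0, d) : ℂ) ^ s = 2 * (riemannZeta (2 * s) * (y : ℂ) ^ s) := by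
  have hs0 : s ≠ 0 := by rintro rfl; simp at hs; linarith
  have h2s : 1 < (2 * s).re := by simp; linarith
  rw [tsum_int_eq_zero_add_two_mul_tsum_pnat]
  · have h0 : (imForm x y (0, 0) : ℂ) ^ s = 0 := by
      rw [show ((0, 0) : ℤ × ℤ) = 0 from rfl, imForm_zero, Complex.ofReal_zero,
        Complex.zero_cpow hs0]
    have h1 : imForm x y (0, 1) = y := by
      simp [imForm]
    have h2 : ∀ n : ℕ+, (imForm x y (0, ((n : ℕ) : ℤ)) : ℂ) ^ s =
        1 / ((n : ℕ) : ℂ) ^ (2 * s) * (y : ℂ) ^ s := by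
      intro n
      have := imForm_mul_cpow x hy n (0, 1) s
      simpa [h1] using this
    simp_rw [h2]
    rw [h0, zero_add, tsum_mul_right, ← zeta_eq_tsum_pnat h2s, nsmul_eq_mul, Nat.cast_ofNat]
  · intro d
    have := imForm_neg x y (0, d)
    simp only [Prod.neg_mk, neg_zero] at this
    simp only [this]
  · exact (summable_imForm_cpow x hy hs).comp_injective (i := fun d : ℤ => ((0 : ℤ), d))
      (fun a b h => (Prod.ext_iff.1 h).2)

/-- This is `poisson_row` with `α = cx` and `β = cy`. The numerator `y^s` turns `(cy)^(1-2s)` into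
`y^(1-s) c^(1-2s)` and the Bessel coefficients into multiples of `√y`. -/
theorem tsum_imForm_row (x : ℝ) {y : ℝ} (hy : 0 < y) {s : ℂ} (hs : 1 < s.re) (c : ℕ+) :
    (Real.pi : ℂ) ^ (-s) * Complex.Gamma s * ∑' d : ℤ, (imForm x y (((c : ℕ) : ℤ), d) : ℂ) ^ s =
      (Real.pi : ℂ) ^ (-(s - 1 / 2)) * Complex.Gamma (s - 1 / 2) * (y : ℂ) ^ (1 - s) *
        (1 / ((c : ℕ) : ℂ) ^ (2 * s - 1)) +
      ∑' m : ℕ+, besselTerm y s (c, m) *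
        (4 * Real.sqrt y * Real.cos (2 * Real.pi * ((m : ℕ) * (c : ℕ)) * x) : ℝ) := by
  have hc : (0 : ℝ) < (c : ℕ) := by exact_mod_cast c.pos
  have hc' : ((c : ℕ) : ℂ) ≠ 0 := by exact_mod_cast c.ne_zero
  have hy' : (y : ℂ) ≠ 0 := Complex.ofReal_ne_zero.2 hy.ne'
  have hsum : Summable fun d : ℤ =>
      (1 / (((c : ℕ) * x + d) ^ 2 + ((c : ℕ) * y) ^ 2)) ^ s.re := by
    have h := ((summable_imForm_rpow x hy hs).comp_injective (i := fun d : ℤ => (((c : ℕ) : ℤ), d))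
      (fun a b h => (Prod.ext_iff.1 h).2)).mul_left (y ^ s.re)⁻¹
    refine h.congr fun d => ?_
    rw [Function.comp, imForm_eq_mul, Real.mul_rpow hy.le (by positivity), ← mul_assoc,
      inv_mul_cancel₀ (by positivity), one_mul, Int.cast_natCast]
  have h := poisson_row ((c : ℕ) * x) (mul_pos hc hy) (by linarith) hsum
  simp_rw [imForm_row_cpow x hy, Int.cast_natCast]
  rw [tsum_mul_left, mul_left_comm, h, mul_add]
  congr 1
  · have e1 : ((1 / ((c : ℕ) * y) ^ 2 : ℝ) : ℂ) ^ (s - 1 / 2) =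
        (1 / ((c : ℕ) : ℂ) ^ (2 * s - 1)) * (y : ℂ) ^ (1 - 2 * s) := by
      have e2 : (1 / ((c : ℕ) * y) ^ 2 : ℝ) = (((c : ℕ) : ℝ) * y) ^ (-2 : ℝ) := by
        rw [Real.rpow_neg (by positivity), one_div, Real.rpow_two]
      rw [e2, Complex.ofReal_cpow (by positivity), ← Complex.cpow_mul]
      · rw [Complex.ofReal_mul, Complex.mul_cpow_ofReal_nonneg hc.le hy.le,
          one_div (((c : ℕ) : ℂ) ^ (2 * s - 1)), ← Complex.cpow_neg, Complex.ofReal_natCast]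
        congr 2 <;> push_cast <;> ring
      · rw [← Complex.ofReal_log (by positivity), ← Complex.ofReal_mul, Complex.ofReal_im]
        linarith [Real.pi_pos]
      · rw [← Complex.ofReal_log (by positivity), ← Complex.ofReal_mul, Complex.ofReal_im]
        exact Real.pi_pos.le
    rw [e1]
    have e3 : (y : ℂ) ^ (1 - s) = (y : ℂ) ^ s * (y : ℂ) ^ (1 - 2 * s) := by
      rw [← Complex.cpow_add _ _ hy']; congr 1; ring
    rw [e3]
    ring
  · rw [← tsum_mul_left]
    refine tsum_congr fun m => ?_
    have hm : (0 : ℝ) < (m : ℕ) := by exact_mod_cast m.pos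
    have e4 : (y : ℂ) ^ s * ((((m : ℕ) / ((c : ℕ) * y)) : ℝ) : ℂ) ^ (s - 1 / 2) =
        (Real.sqrt y : ℂ) * (((m : ℕ) / (c : ℕ) : ℝ) : ℂ) ^ (s - 1 / 2) := by
      have e5 : ((((m : ℕ) / (c : ℕ)) : ℝ) : ℂ) ^ (s - 1 / 2) =
          ((((m : ℕ) / ((c : ℕ) * y)) : ℝ) : ℂ) ^ (s - 1 / 2) * (y : ℂ) ^ (s - 1 / 2) := by
        rw [← Complex.mul_cpow_ofReal_nonneg (by positivity) hy.le, ← Complex.ofReal_mul]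
        congr 2
        field_simp
      have e6 : (Real.sqrt y : ℂ) = (y : ℂ) ^ (1 / 2 : ℂ) := by
        rw [Real.sqrt_eq_rpow, Complex.ofReal_cpow hy.le]; norm_num
      have e7 : (y : ℂ) ^ s = (y : ℂ) ^ (1 / 2 : ℂ) * (y : ℂ) ^ (s - 1 / 2) := by
        rw [← Complex.cpow_add _ _ hy']; congr 1; ring
      rw [e5, e6, e7]
      ring
    rw [← mul_assoc, ← mul_assoc, e4, besselTerm]
    have e8 : 2 * Real.pi * (m : ℕ) * ((c : ℕ) * y) = 2 * Real.pi * (m : ℕ) * (c : ℕ) * y := by ring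
    have e9 : 2 * Real.pi * (m : ℕ) * ((c : ℕ) * x) = 2 * Real.pi * ((m : ℕ) * (c : ℕ)) * x := by
      ring
    rw [e8, e9]
    push_cast
    ring

/-- The row `c = 0` gives `ζ(2s) y^s`. The rows `c` and `-c` agree by `v ↦ -v`, and summing
`c^(1-2s)` over `c ≥ 1` gives `ζ(2s-1)`; the Gamma factors complete both zeta values. -/
theorem latticeSum_fourier (x : ℝ) {y : ℝ} (hy : 0 < y) {s : ℂ} (hs : 1 < s.re) :
    Complex.Gammaℝ (2 * s) * latticeSum x y s =
      2 * (completedRiemannZeta (2 * s) * (y : ℂ) ^ s +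
        completedRiemannZeta (2 * s - 1) * (y : ℂ) ^ (1 - s) + besselSum x y s) := by
  have h2s : 1 < (2 * s - 1).re := by simp; linarith
  have hG : ∀ w : ℂ, 1 < w.re → completedRiemannZeta w = Complex.Gammaℝ w * riemannZeta w := by
    intro w hw
    have hw0 : w ≠ 0 := by rintro rfl; simp at hw; linarith
    rw [riemannZeta_def_of_ne_zero hw0,
      mul_div_cancel₀ _ (Complex.Gammaℝ_ne_zero_of_re_pos (by linarith))]
  have hGs : Complex.Gammaℝ (2 * s) = (Real.pi : ℂ) ^ (-s) * Complex.Gamma s := by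
    rw [Complex.Gammaℝ_def]; congr 2 <;> ring
  have hGs' : Complex.Gammaℝ (2 * s - 1) =
      (Real.pi : ℂ) ^ (-(s - 1 / 2)) * Complex.Gamma (s - 1 / 2) := by
    rw [Complex.Gammaℝ_def]; congr 2 <;> ring
  have hsum := summable_imForm_cpow x hy hs
  have hsumc : Summable fun c : ℤ => ∑' d : ℤ, (imForm x y (c, d) : ℂ) ^ s := hsum.prod
  rw [latticeSum, hsum.tsum_prod, tsum_int_eq_zero_add_two_mul_tsum_pnat _ hsumc,
    tsum_imForm_zero x hy hs, mul_add, nsmul_eq_mul, mul_left_comm _ (2 : ℂ), Nat.cast_ofNat,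
    mul_left_comm _ (2 : ℂ), ← mul_assoc _ (riemannZeta _), ← hG _ (by simp; linarith),
    ← tsum_mul_left, hGs]
  · simp_rw [tsum_imForm_row x hy hs]
    have hb := summable_besselSum_term x hy s
    have hz : Summable fun c : ℕ+ => 1 / ((c : ℕ) : ℂ) ^ (2 * s - 1) :=
      (Complex.summable_one_div_nat_cpow.2 h2s).comp_injective PNat.coe_injective
    rw [Summable.tsum_add (hz.mul_left _) hb.prod, tsum_mul_left, ← zeta_eq_tsum_pnat h2s,
      ← hGs', hG _ h2s, besselSum, hb.tsum_prod]
    ring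
  · intro c
    beta_reduce
    rw [← (Equiv.neg ℤ).tsum_eq]
    refine tsum_congr fun d => ?_
    have := imForm_neg x y (c, d)
    simp only [Prod.neg_mk] at this
    rw [Equiv.neg_apply, this]

/-! ### The meromorphic continuation -/

/-- The entire function `w (w - 1) ζ^*(w)`. -/
noncomputable def xiFun (w : ℂ) : ℂ := w * (w - 1) * completedRiemannZeta₀ w + 1

theorem differentiable_xiFun : Differentiable ℂ xiFun := by
  have := differentiable_completedZeta₀
  unfold xiFun
  fun_prop

/-- The polar part of `ζ^*` is `-1/w - 1/(1-w)`, and multiplication by `w(w-1)` turns it into the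
constant `1`. -/
theorem xiFun_eq {w : ℂ} (h0 : w ≠ 0) (h1 : w ≠ 1) :
    xiFun w = w * (w - 1) * completedRiemannZeta w := by
  have h2 : 1 - w ≠ 0 := sub_ne_zero.2 h1.symm
  rw [xiFun, completedRiemannZeta_eq]
  field_simp
  ring

theorem xiFun_one : xiFun 1 = 1 := by simp [xiFun]

/-- The factor `1 / ζ^*(2s)`, with the value `0` at `s = 1/2`. -/
noncomputable def zetaFactor (s : ℂ) : ℂ := 2 * s * (2 * s - 1) / xiFun (2 * s)

/-- The meromorphic continuation of the Eisenstein series of level one at `x + iy`. -/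
noncomputable def eisExt (x y : ℝ) (s : ℂ) : ℂ :=
  (y : ℂ) ^ s + 2 * s * xiFun (2 * s - 1) / ((2 * s - 2) * xiFun (2 * s)) * (y : ℂ) ^ (1 - s) +
    zetaFactor s * besselSum x y s

/-- At `2s = 1`, where `ζ^*` has a pole and its assigned value means nothing, the explicit value
`xiFun 1 = 1` serves. -/
theorem xiFun_ne_zero {s : ℂ} (h0 : s ≠ 0) (hζ : completedRiemannZeta (2 * s) ≠ 0) :
    xiFun (2 * s) ≠ 0 := by
  by_cases h : 2 * s = 1
  · rw [h, xiFun_one]; exact one_ne_zero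
  · rw [xiFun_eq (by simpa using h0) h]
    exact mul_ne_zero (mul_ne_zero (by simpa using h0) (sub_ne_zero.2 h)) hζ

theorem zetaFactor_eq {s : ℂ} (h0 : s ≠ 0) :
    zetaFactor s = if s = 1 / 2 then 0 else 1 / completedRiemannZeta (2 * s) := by
  split_ifs with h
  · simp [zetaFactor, h]
  · have h1 : 2 * s ≠ 1 := fun h' => h (by linear_combination h' / 2)
    rw [zetaFactor, xiFun_eq (by simpa using h0) h1, ← div_div, div_self]
    exact mul_ne_zero (by simpa using h0) (sub_ne_zero.2 h1)

theorem completedRiemannZeta_ne_zero {w : ℂ} (hw : 1 < w.re) : completedRiemannZeta w ≠ 0 := by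
  intro h
  have hw0 : w ≠ 0 := by rintro rfl; simp at hw; linarith
  have := riemannZeta_ne_zero_of_one_le_re hw.le
  rw [riemannZeta_def_of_ne_zero hw0, h, zero_div] at this
  exact this rfl

theorem two_zeta_mul_eisExt (x : ℝ) {y : ℝ} (hy : 0 < y) {s : ℂ} (hs : 1 < s.re) :
    2 * riemannZeta (2 * s) * eisExt x y s = latticeSum x y s := by
  have h2s : 1 < (2 * s).re := by simp; linarith
  have hs0 : s ≠ 0 := by rintro rfl; simp at hs; linarith
  have h2s0 : 2 * s ≠ 0 := by simpa using hs0
  have hs1 : s ≠ 1 := by rintro rfl; simp at hs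
  have h21 : 2 * s ≠ 1 := by intro h; rw [h] at h2s; simp at h2s
  have hζ := completedRiemannZeta_ne_zero h2s
  have hG := Complex.Gammaℝ_ne_zero_of_re_pos (s := 2 * s) (by linarith)
  have h := latticeSum_fourier x hy hs
  have a1 : 2 * s - 1 ≠ 0 := sub_ne_zero.2 h21
  have a2 : 2 * s - 1 - 1 ≠ 0 := fun h' => hs1 (by linear_combination h' / 2)
  have a3 : 2 * s - 2 ≠ 0 := fun h' => hs1 (by linear_combination h' / 2)
  rw [eisExt, zetaFactor, xiFun_eq h2s0 h21, xiFun_eq a1 (fun h' => a2 (by rw [h', sub_self])),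
    riemannZeta_def_of_ne_zero h2s0]
  apply mul_left_cancel₀ hG
  rw [h]
  have e : 2 * s - 1 - 1 = 2 * s - 2 := by ring
  rw [e]
  field_simp

theorem differentiable_ofReal_cpow {y : ℝ} (hy : 0 < y) : Differentiable ℂ fun s : ℂ => (y : ℂ) ^ s :=
  fun _ => differentiableAt_id.const_cpow (Or.inl (Complex.ofReal_ne_zero.2 hy.ne'))

theorem analyticAt_eisExt_parts (x : ℝ) {y : ℝ} (hy : 0 < y) (s : ℂ) :
    AnalyticAt ℂ (fun s : ℂ => (y : ℂ) ^ s) s ∧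
    AnalyticAt ℂ (fun s : ℂ => 2 * s * xiFun (2 * s - 1)) s ∧
    AnalyticAt ℂ (fun s : ℂ => (2 * s - 2) * xiFun (2 * s)) s ∧
    AnalyticAt ℂ (fun s : ℂ => (y : ℂ) ^ (1 - s)) s ∧
    AnalyticAt ℂ (fun s : ℂ => 2 * s * (2 * s - 1)) s ∧
    AnalyticAt ℂ (fun s : ℂ => xiFun (2 * s)) s ∧
    AnalyticAt ℂ (fun s : ℂ => besselSum x y s) s := by
  have h1 := differentiable_ofReal_cpow hy
  have h2 := differentiable_xiFun
  have h3 := differentiable_besselSum x hy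
  refine ⟨?_, ?_, ?_, ?_, ?_, ?_, ?_⟩
  · exact h1.analyticAt s
  · exact Differentiable.analyticAt (by fun_prop) s
  · exact Differentiable.analyticAt (by fun_prop) s
  · exact Differentiable.analyticAt
      (h1.comp (differentiable_const (1 : ℂ) |>.sub differentiable_id)) s
  · exact Differentiable.analyticAt (by fun_prop) s
  · exact Differentiable.analyticAt (by fun_prop) s
  · exact h3.analyticAt s

/-- In terms of `xiFun` the quotient `ζ^*(2s-1)/ζ^*(2s)` loses its common factor `2s - 1`, so `s =
1/2` is an ordinary point. Only `s = 1` and zeros of `xiFun (2s)` have to be avoided. -/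
theorem analyticAt_eisExt (x : ℝ) {y : ℝ} (hy : 0 < y) {s : ℂ} (hs : s ≠ 1)
    (hD : xiFun (2 * s) ≠ 0) : AnalyticAt ℂ (eisExt x y) s := by
  obtain ⟨h1, h2, h3, h4, h5, h6, h7⟩ := analyticAt_eisExt_parts x hy s
  have hne : (2 * s - 2) * xiFun (2 * s) ≠ 0 :=
    mul_ne_zero (fun h' => hs (by linear_combination h' / 2)) hD
  exact (h1.add ((h2.div h3 hne).mul h4)).add ((h5.div h6 hD).mul h7)

theorem meromorphicAt_eisExt (x : ℝ) {y : ℝ} (hy : 0 < y) (s : ℂ) :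
    MeromorphicAt (eisExt x y) s := by
  obtain ⟨h1, h2, h3, h4, h5, h6, h7⟩ := analyticAt_eisExt_parts x hy s
  exact (h1.meromorphicAt.add ((h2.meromorphicAt.div h3.meromorphicAt).mul h4.meromorphicAt)).add
    ((h5.meromorphicAt.div h6.meromorphicAt).mul h7.meromorphicAt)

/-! ### Continuation at level `p` -/

theorem natCast_cpow_ne_one {p : ℕ} (hp : 1 < p) {w : ℂ} (hw : 0 < w.re) : (p : ℂ) ^ w ≠ 1 := by
  intro h
  have h1 : ‖(p : ℂ) ^ w‖ = (p : ℝ) ^ w.re := Complex.norm_natCast_cpow_of_pos (by omega) w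
  rw [h, norm_one] at h1
  exact absurd h1.symm (Real.one_lt_rpow (by exact_mod_cast hp) hw).ne'

/-- A function of the form `(a ^ s F(s) + b G(s)) / (p ^ (2 s) - 1)` built from two level one
Eisenstein series continues the series that it represents for `Re s > 1`. -/
theorem meroCont_level {p : ℕ} (hp : p.Prime) {f : ℂ → ℂ} {F G : ℂ → ℂ}
    (hF : ∀ s, MeromorphicAt F s) (hG : ∀ s, MeromorphicAt G s)
    (hF' : ∀ s : ℂ, s ≠ 1 → xiFun (2 * s) ≠ 0 → AnalyticAt ℂ F s)
    (hG' : ∀ s : ℂ, s ≠ 1 → xiFun (2 * s) ≠ 0 → AnalyticAt ℂ G s)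
    (h : ∀ s : ℂ, 1 < s.re → ((p : ℂ) ^ (2 * s) - 1) * f s = (p : ℂ) ^ s * F s - G s)
    {s : ℂ} (hs : s ≠ 1) (hD : xiFun (2 * s) ≠ 0) (hps : (p : ℂ) ^ (2 * s) ≠ 1) :
    meroCont f s = ((p : ℂ) ^ s * F s - G s) / ((p : ℂ) ^ (2 * s) - 1) := by
  have hp0 : (p : ℂ) ≠ 0 := by exact_mod_cast hp.ne_zero
  have hpow : Differentiable ℂ fun s : ℂ => (p : ℂ) ^ s :=
    fun _ => differentiableAt_id.const_cpow (Or.inl hp0)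
  have hden : Differentiable ℂ fun s : ℂ => (p : ℂ) ^ (2 * s) - 1 :=
    (hpow.comp (differentiable_id.const_mul 2)).sub_const 1
  have hana : ∀ s : ℂ, s ≠ 1 → xiFun (2 * s) ≠ 0 → (p : ℂ) ^ (2 * s) ≠ 1 →
      AnalyticAt ℂ (fun s => ((p : ℂ) ^ s * F s - G s) / ((p : ℂ) ^ (2 * s) - 1)) s :=
    fun s h1 h2 h3 => (((hpow.analyticAt s).mul (hF' s h1 h2)).sub (hG' s h1 h2)).div
      (hden.analyticAt s) (sub_ne_zero.2 h3)
  refine meroCont_eq (F := fun s => ((p : ℂ) ^ s * F s - G s) / ((p : ℂ) ^ (2 * s) - 1))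
    (fun s _ => ?_) (fun w hw => ?_) (fun w hw => ?_) (hana s hs hD hps)
  · exact (((hpow.analyticAt s).meromorphicAt.mul (hF s)).sub (hG s)).div
      (hden.analyticAt s).meromorphicAt
  · have h2w : 1 < (2 * w).re := by simp; linarith
    refine hana w (by rintro rfl; simp at hw)
      (xiFun_ne_zero (by rintro rfl; simp at hw; linarith) (completedRiemannZeta_ne_zero h2w))
      (natCast_cpow_ne_one hp.one_lt (by linarith))
  · have h2w : 1 < (2 * w).re := by simp; linarith
    have hne := sub_ne_zero.2 (natCast_cpow_ne_one hp.one_lt (by linarith : 0 < (2 * w).re))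
    rw [← h w hw, mul_div_cancel_left₀ _ hne]

theorem eisenstein_full (z : ℍ) {s : ℂ} (hs : s ≠ 1) (hD : xiFun (2 * s) ≠ 0) :
    eisenstein cuspFull z s = eisExt z.re z.im s := by
  have hana : ∀ w : ℂ, w ≠ 1 → xiFun (2 * w) ≠ 0 → AnalyticAt ℂ (eisExt z.re z.im) w :=
    fun w h1 h2 => analyticAt_eisExt _ z.im_pos h1 h2
  refine meroCont_eq (fun w _ => meromorphicAt_eisExt _ z.im_pos w) (fun w hw => ?_)
    (fun w hw => ?_) (hana s hs hD)
  · have h2w : 1 < (2 * w).re := by simp; linarith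
    exact hana w (by rintro rfl; simp at hw)
      (xiFun_ne_zero (by rintro rfl; simp at hw; linarith) (completedRiemannZeta_ne_zero h2w))
  · have h2w : 1 < (2 * w).re := by simp; linarith
    have hζ := riemannZeta_ne_zero_of_one_le_re h2w.le
    have h1 := two_zeta_mul_eisExt z.re z.im_pos hw
    rw [latticeSum_eq_zeta_mul _ z.im_pos hw, ← eisensteinSeries_full z hw] at h1
    have h2 : (2 * riemannZeta (2 * w)) ≠ 0 := mul_ne_zero two_ne_zero hζ
    apply mul_left_cancel₀ h2
    linear_combination h1

/-- With `T` and `T'` the primitive sums over `p ∣ c` and `p ∤ c`, one has `L(z) = ζ(2s)(T + T')`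
and `L(pz) = p^s ζ(2s)(T + p^(-2s) T')`. Each right-hand side eliminates one of the two. -/
theorem level_eisensteinSeries {p : ℕ} (hp : p.Prime) (z : ℍ) {s : ℂ} (hs : 1 < s.re) :
    (2 * riemannZeta (2 * s) * (((p : ℂ) ^ (2 * s) - 1) * eisensteinSeries (cuspInfty p) z s) =
      (p : ℂ) ^ s * latticeSum (p * z.re) (p * z.im) s - latticeSum z.re z.im s) ∧
    (2 * riemannZeta (2 * s) *
      (((p : ℂ) ^ (2 * s) - 1) * eisensteinSeries (cuspZero p hp.pos) z s) =
      (p : ℂ) ^ s * latticeSum z.re z.im s - latticeSum (p * z.re) (p * z.im) s) := by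
  have hp0 : (p : ℂ) ≠ 0 := by exact_mod_cast hp.ne_zero
  have hps : (p : ℂ) ^ s ≠ 0 := by simp [Complex.cpow_eq_zero_iff, hp0]
  have h1 := eisensteinSeries_cuspInfty p z hs
  have h2 := eisensteinSeries_cuspZero hp z hs
  have h3 := latticeSum_dilate hp z.re z.im_pos hs
  have h4 := latticeSum_eq_zeta_mul z.re z.im_pos hs
  rw [tsum_primitivePairs_split p z.re z.im_pos hs] at h4
  have e : (p : ℂ) ^ (2 * s) = (p : ℂ) ^ s * (p : ℂ) ^ s := by
    rw [two_mul, Complex.cpow_add _ _ hp0]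
  rw [e] at h3 ⊢
  rw [h3, h4]
  generalize (p : ℂ) ^ s = P at *
  generalize (∑' u, (primitivePairs ∩ {u | (p : ℤ) ∣ u.1}).indicator
    (fun u => (imForm z.re z.im u : ℂ) ^ s) u) = T at *
  generalize (∑' u, (primitivePairs ∩ {u | ¬ (p : ℤ) ∣ u.1}).indicator
    (fun u => (imForm z.re z.im u : ℂ) ^ s) u) = T' at *
  constructor
  · rw [mul_comm 2, mul_assoc, mul_left_comm (2 : ℂ), h1]
    field_simp
    ring
  · rw [mul_comm 2, mul_assoc, mul_left_comm (2 : ℂ), h2]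
    field_simp
    ring

theorem tauZero_smul (p : ℕ) (hp : 0 < p) (z : ℍ) :
    (tauZero p hp • z).re = -z.re / (p * (z.re ^ 2 + z.im ^ 2)) ∧
    (tauZero p hp • z).im = z.im / (p * (z.re ^ 2 + z.im ^ 2)) := by
  have hp0 : (0 : ℝ) < p := by exact_mod_cast hp
  have hsq : Real.sqrt p ^ 2 = p := Real.sq_sqrt hp0.le
  have hs0 : Real.sqrt p ≠ 0 := by positivity
  constructor
  · have h : ((tauZero p hp • z : ℍ) : ℂ) = -1 / (p * z) := by
      rw [UpperHalfPlane.coe_specialLinearGroup_apply]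
      have hz : (z : ℂ) ≠ 0 := z.ne_zero
      have hs0' : (Real.sqrt p : ℂ) ≠ 0 := Complex.ofReal_ne_zero.2 hs0
      have hsq' : (Real.sqrt p : ℂ) ^ 2 = p := by exact_mod_cast hsq
      simp [tauZero]
      rw [← hsq']
      field_simp
    have h2 : (tauZero p hp • z).re = ((tauZero p hp • z : ℍ) : ℂ).re := rfl
    rw [h2, h, Complex.div_re]
    have hn : 0 < z.re ^ 2 + z.im ^ 2 := by have := z.im_pos; positivity
    simp [Complex.normSq_apply]
    field_simp
  · rw [im_smul_eq]
    have e1 : tauZero p hp 1 0 = -Real.sqrt p := rfl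
    have e2 : tauZero p hp 1 1 = 0 := rfl
    rw [e1, e2]
    congr 1
    linear_combination (z.re ^ 2 + z.im ^ 2) * hsq

/-- Here `τ_0 z = -1/(pz)` and `p τ_0 z = -1/z`, so `τ_0` exchanges the lattice sums at `z` and
`pz`. -/
theorem latticeSum_tauZero {p : ℕ} (hp : 0 < p) (z : ℍ) (s : ℂ) :
    latticeSum (tauZero p hp • z).re (tauZero p hp • z).im s =
      latticeSum (p * z.re) (p * z.im) s ∧
    latticeSum (p * (tauZero p hp • z).re) (p * (tauZero p hp • z).im) s =
      latticeSum z.re z.im s := by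
  have hp0 : (0 : ℝ) < p := by exact_mod_cast hp
  have hy := z.im_pos
  have hn : 0 < z.re ^ 2 + z.im ^ 2 := by positivity
  obtain ⟨h1, h2⟩ := tauZero_smul p hp z
  rw [h1, h2]
  constructor
  · rw [← latticeSum_inversion (p * z.re) (p * z.im) (by positivity)]
    congr 1 <;> field_simp
  · rw [← latticeSum_inversion z.re z.im hy]
    congr 1 <;> field_simp

/-- The continuation of `E_∞(z)` and of `E_0(τ_0 z)` for `Γ₀(p)`. -/
noncomputable def levelExt (p : ℕ) (x y : ℝ) (s : ℂ) : ℂ :=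
  ((p : ℂ) ^ s * eisExt (p * x) (p * y) s - eisExt x y s) / ((p : ℂ) ^ (2 * s) - 1)

/-- The continuation of `E_0(z)` and of `E_∞(τ_0 z)` for `Γ₀(p)`. -/
noncomputable def levelExt' (p : ℕ) (x y : ℝ) (s : ℂ) : ℂ :=
  ((p : ℂ) ^ s * eisExt x y s - eisExt (p * x) (p * y) s) / ((p : ℂ) ^ (2 * s) - 1)

theorem meroCont_eq_levelExt {p : ℕ} (hp : p.Prime) (z : ℍ) {s : ℂ} (hs : s ≠ 1)
    (hD : xiFun (2 * s) ≠ 0) (hps : (p : ℂ) ^ (2 * s) ≠ 1) {f : ℂ → ℂ}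
    (h : ∀ w : ℂ, 1 < w.re → 2 * riemannZeta (2 * w) * (((p : ℂ) ^ (2 * w) - 1) * f w) =
      (p : ℂ) ^ w * latticeSum (p * z.re) (p * z.im) w - latticeSum z.re z.im w) :
    meroCont f s = levelExt p z.re z.im s := by
  have hp0 : (0 : ℝ) < p := by exact_mod_cast hp.pos
  have hy := z.im_pos
  have hpy : 0 < p * z.im := mul_pos hp0 hy
  refine meroCont_level hp (meromorphicAt_eisExt _ hpy) (meromorphicAt_eisExt _ hy)
    (fun _ => analyticAt_eisExt _ hpy) (fun _ => analyticAt_eisExt _ hy) (fun w hw => ?_) hs hD hps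
  have h2w : 1 < (2 * w).re := by simp; linarith
  apply mul_left_cancel₀ (mul_ne_zero two_ne_zero (riemannZeta_ne_zero_of_one_le_re h2w.le))
  rw [h w hw, ← two_zeta_mul_eisExt _ hy hw, ← two_zeta_mul_eisExt _ hpy hw]
  ring

theorem meroCont_eq_levelExt' {p : ℕ} (hp : p.Prime) (z : ℍ) {s : ℂ} (hs : s ≠ 1)
    (hD : xiFun (2 * s) ≠ 0) (hps : (p : ℂ) ^ (2 * s) ≠ 1) {f : ℂ → ℂ}
    (h : ∀ w : ℂ, 1 < w.re → 2 * riemannZeta (2 * w) * (((p : ℂ) ^ (2 * w) - 1) * f w) =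
      (p : ℂ) ^ w * latticeSum z.re z.im w - latticeSum (p * z.re) (p * z.im) w) :
    meroCont f s = levelExt' p z.re z.im s := by
  have hp0 : (0 : ℝ) < p := by exact_mod_cast hp.pos
  have hy := z.im_pos
  have hpy : 0 < p * z.im := mul_pos hp0 hy
  refine meroCont_level hp (meromorphicAt_eisExt _ hy) (meromorphicAt_eisExt _ hpy)
    (fun _ => analyticAt_eisExt _ hy) (fun _ => analyticAt_eisExt _ hpy) (fun w hw => ?_) hs hD hps
  have h2w : 1 < (2 * w).re := by simp; linarith
  apply mul_left_cancel₀ (mul_ne_zero two_ne_zero (riemannZeta_ne_zero_of_one_le_re h2w.le))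
  rw [h w hw, ← two_zeta_mul_eisExt _ hy hw, ← two_zeta_mul_eisExt _ hpy hw]
  ring

theorem eisenstein_infty_infty {p : ℕ} (hp : p.Prime) (z : ℍ) {s : ℂ} (hs : s ≠ 1)
    (hD : xiFun (2 * s) ≠ 0) (hps : (p : ℂ) ^ (2 * s) ≠ 1) :
    eisenstein (cuspInfty p) ((cuspInfty p).scaling • z) s = levelExt p z.re z.im s := by
  have : (cuspInfty p).scaling • z = z := one_smul _ z
  rw [this]
  exact meroCont_eq_levelExt hp z hs hD hps fun w hw => (level_eisensteinSeries hp z hw).1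

theorem eisenstein_infty_zero {p : ℕ} (hp : p.Prime) (z : ℍ) {s : ℂ} (hs : s ≠ 1)
    (hD : xiFun (2 * s) ≠ 0) (hps : (p : ℂ) ^ (2 * s) ≠ 1) :
    eisenstein (cuspZero p hp.pos) ((cuspInfty p).scaling • z) s = levelExt' p z.re z.im s := by
  have : (cuspInfty p).scaling • z = z := one_smul _ z
  rw [this]
  exact meroCont_eq_levelExt' hp z hs hD hps fun w hw => (level_eisensteinSeries hp z hw).2

theorem eisenstein_zero_infty {p : ℕ} (hp : p.Prime) (z : ℍ) {s : ℂ} (hs : s ≠ 1)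
    (hD : xiFun (2 * s) ≠ 0) (hps : (p : ℂ) ^ (2 * s) ≠ 1) :
    eisenstein (cuspInfty p) ((cuspZero p hp.pos).scaling • z) s = levelExt' p z.re z.im s := by
  refine meroCont_eq_levelExt' hp z hs hD hps fun w hw => ?_
  obtain ⟨h1, h2⟩ := latticeSum_tauZero hp.pos z w
  rw [← h1, ← h2]
  exact (level_eisensteinSeries hp _ hw).1

theorem eisenstein_zero_zero {p : ℕ} (hp : p.Prime) (z : ℍ) {s : ℂ} (hs : s ≠ 1)
    (hD : xiFun (2 * s) ≠ 0) (hps : (p : ℂ) ^ (2 * s) ≠ 1) :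
    eisenstein (cuspZero p hp.pos) ((cuspZero p hp.pos).scaling • z) s =
      levelExt p z.re z.im s := by
  refine meroCont_eq_levelExt hp z hs hD hps fun w hw => ?_
  obtain ⟨h1, h2⟩ := latticeSum_tauZero hp.pos z w
  rw [← h1, ← h2]
  exact (level_eisensteinSeries hp _ hw).2

/-! ### Fourier coefficients -/

/-- The defining identity is evaluated at the `y` for which `2π|m|y` is a point where the Bessel
function does not vanish. -/
theorem IsEisCoeff.unique {𝔞 𝔟 : ScaledCusp Γ} {s : ℂ} {m : ℤ} (hm : m ≠ 0) {c c' : ℂ}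
    (h : IsEisCoeff 𝔞 𝔟 s m c) (h' : IsEisCoeff 𝔞 𝔟 s m c') : c = c' := by
  obtain ⟨w, hw, hK⟩ := exists_besselK_ne_zero (s - 1 / 2)
  have hm' : 0 < |(m : ℝ)| := abs_pos.2 (by exact_mod_cast hm)
  have hpi := Real.pi_pos
  set y := w / (2 * Real.pi * |(m : ℝ)|) with hy
  have hy0 : 0 < y := by positivity
  have e : 2 * Real.pi * |(m : ℝ)| * y = w := by rw [hy]; field_simp
  have h1 := (h y hy0).2.symm.trans (h' y hy0).2
  rw [e] at h1
  refine mul_right_cancel₀ (mul_ne_zero (mul_ne_zero two_ne_zero ?_) hK) h1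
  rw [Complex.ofReal_ne_zero]
  positivity

theorem IsEisCoeff.eisCoeff_eq {𝔞 𝔟 : ScaledCusp Γ} {s : ℂ} {m : ℤ} (hm : m ≠ 0) {c : ℂ}
    (h : IsEisCoeff 𝔞 𝔟 s m c) : eisCoeff 𝔞 𝔟 s m = c := by
  have hex : ∃ c : ℂ, IsEisCoeff 𝔞 𝔟 s m c := ⟨c, h⟩
  rw [eisCoeff, dif_pos hex]
  exact IsEisCoeff.unique hm hex.choose_spec h

/-- The Fourier coefficient of a function that is a combination of `besselSum` at `z` and at
`q z`, up to a function of `y`. -/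
theorem isEisCoeff_of_eq {𝔞 𝔟 : ScaledCusp Γ} {s : ℂ} {m : ℤ} (hm : m ≠ 0) {q : ℕ} (hq : 0 < q)
    (a : ℝ → ℂ) (b b' : ℂ)
    (h : ∀ z : ℍ, eisenstein 𝔟 (𝔞.scaling • z) s = a z.im + b * besselSum z.re z.im s +
      b' * besselSum (q * z.re) (q * z.im) s) :
    IsEisCoeff 𝔞 𝔟 s m (b * divisorTau (s - 1 / 2) m + if (q : ℤ) ∣ m then
      b' * (Real.sqrt q * divisorTau (s - 1 / 2) (m / q)) else 0) := by
  intro y hy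
  have hq0 : (0 : ℝ) < q := by exact_mod_cast hq
  have hqy : 0 < q * y := mul_pos hq0 hy
  set e : ℝ → ℂ := fun x => Complex.exp (-(2 * Real.pi * Complex.I * m * x)) with he
  have hec : Continuous e := by fun_prop
  have hf : fourierIntegrand 𝔞 𝔟 s m y hy = fun x => a y * e x + b * (besselSum x y s * e x) +
      b' * (besselSum (q * x) (q * y) s * e x) := by
    funext x
    rw [fourierIntegrand, h]
    change (a y + b * besselSum x y s + b' * besselSum (q * x) (q * y) s) * e x = _
    ring
  have hW := continuous_besselSum hy s
  have hW' : Continuous fun x : ℝ => besselSum (q * x) (q * y) s :=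
    (continuous_besselSum hqy s).comp (continuous_const.mul continuous_id)
  have i1 : Continuous fun x => a y * e x := by fun_prop
  have i2 : Continuous fun x => b * (besselSum x y s * e x) := by fun_prop
  have i12 : Continuous fun x => a y * e x + b * (besselSum x y s * e x) := i1.add i2
  have i3 : Continuous fun x : ℝ => b' * (besselSum (q * x) (q * y) s * e x) := by fun_prop
  rw [hf]
  refine ⟨(i12.add i3).intervalIntegrable _ _, ?_⟩
  beta_reduce
  rw [intervalIntegral.integral_add (i12.intervalIntegrable _ _)
    (i3.intervalIntegrable _ _), intervalIntegral.integral_add (i1.intervalIntegrable _ _)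
    (i2.intervalIntegrable _ _), intervalIntegral.integral_const_mul,
    intervalIntegral.integral_const_mul, intervalIntegral.integral_const_mul,
    integral_besselSum hq hqy s hm]
  -- The terms depending only on `y` drop out because `m ≠ 0`.
  have h0 : ∫ x in (0 : ℝ)..1, e x = 0 := by
    have := integral_exp_two_pi_int (-m)
    rw [if_neg (by simpa using hm)] at this
    rw [← this]
    congr 1
    funext x
    simp only [he]
    congr 1
    push_cast
    ring
  have h1 : ∫ x in (0 : ℝ)..1, besselSum x y s * e x = divisorTau (s - 1 / 2) m *
      (2 * Real.sqrt y * besselK (s - 1 / 2) (2 * Real.pi * |(m : ℝ)| * y)) := by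
    have := integral_besselSum one_pos hy s hm
    simpa using this
  rw [h0, h1]
  split_ifs with hdvd
  · obtain ⟨N, rfl⟩ := hdvd
    have hqz : (q : ℤ) ≠ 0 := by exact_mod_cast hq.ne'
    -- The Bessel argument for the frequency `m/q` at height `qy` is the one for `m` at height `y`;
    -- only `√(qy)` leaves a trace, the factor `√q`.
    rw [Int.mul_ediv_cancel_left _ hqz, Real.sqrt_mul hq0.le]
    have e1 : 2 * Real.pi * |((q * N : ℤ) : ℝ)| * y = 2 * Real.pi * |(N : ℝ)| * (q * y) := by
      rw [Int.cast_mul, abs_mul, Int.cast_natCast, abs_of_pos hq0]; ring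
    rw [e1]
    push_cast
    ring
  · ring

theorem isEisCoeff_full {m : ℤ} (hm : m ≠ 0) {s : ℂ} (hs : s ≠ 1) (hD : xiFun (2 * s) ≠ 0) :
    IsEisCoeff cuspFull cuspFull s m (zetaFactor s * divisorTau (s - 1 / 2) m) := by
  have h := isEisCoeff_of_eq (𝔞 := cuspFull) (𝔟 := cuspFull) (s := s) hm (q := 1) one_pos
    (fun y => (y : ℂ) ^ s +
      2 * s * xiFun (2 * s - 1) / ((2 * s - 2) * xiFun (2 * s)) * (y : ℂ) ^ (1 - s))
    (zetaFactor s) 0 (fun z => by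
      have : (cuspFull).scaling • z = z := one_smul _ z
      rw [this, eisenstein_full z hs hD, eisExt]
      ring)
  simpa using h

theorem isEisCoeff_of_eq_levelExt {p : ℕ} (hp : p.Prime) {m : ℤ} (hm : m ≠ 0) {s : ℂ}
    {𝔞 𝔟 : ScaledCusp Γ}
    (h : ∀ z : ℍ, eisenstein 𝔟 (𝔞.scaling • z) s = levelExt p z.re z.im s) :
    IsEisCoeff 𝔞 𝔟 s m (1 / ((p : ℂ) ^ (2 * s) - 1) *
      ((if (p : ℤ) ∣ m then (p : ℂ) ^ (s + 1 / 2) *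
        (zetaFactor s * divisorTau (s - 1 / 2) (m / p)) else 0) -
          zetaFactor s * divisorTau (s - 1 / 2) m)) := by
  have hp0 : (p : ℂ) ≠ 0 := by exact_mod_cast hp.ne_zero
  set A : ℝ → ℂ := fun y => (y : ℂ) ^ s +
      2 * s * xiFun (2 * s - 1) / ((2 * s - 2) * xiFun (2 * s)) * (y : ℂ) ^ (1 - s) with hA
  have key := isEisCoeff_of_eq (𝔞 := 𝔞) (𝔟 := 𝔟) (s := s) hm hp.pos
    (fun y => ((p : ℂ) ^ s * A (p * y) - A y) / ((p : ℂ) ^ (2 * s) - 1))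
    (-zetaFactor s / ((p : ℂ) ^ (2 * s) - 1)) ((p : ℂ) ^ s * zetaFactor s / ((p : ℂ) ^ (2 * s) - 1))
    (fun z => by
      rw [h, levelExt, eisExt, eisExt, hA]
      ring)
  convert key using 1
  have e : (p : ℂ) ^ (s + 1 / 2) = (p : ℂ) ^ s * (Real.sqrt p : ℂ) := by
    rw [Complex.cpow_add _ _ hp0, Real.sqrt_eq_rpow, Complex.ofReal_cpow (Nat.cast_nonneg p)]
    norm_num
  rw [e]
  split_ifs <;> ring

theorem isEisCoeff_of_eq_levelExt' {p : ℕ} (hp : p.Prime) {m : ℤ} (hm : m ≠ 0) {s : ℂ}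
    {𝔞 𝔟 : ScaledCusp Γ}
    (h : ∀ z : ℍ, eisenstein 𝔟 (𝔞.scaling • z) s = levelExt' p z.re z.im s) :
    IsEisCoeff 𝔞 𝔟 s m (1 / ((p : ℂ) ^ (2 * s) - 1) *
      ((p : ℂ) ^ s * (zetaFactor s * divisorTau (s - 1 / 2) m) - if (p : ℤ) ∣ m then
        (Real.sqrt p : ℂ) * (zetaFactor s * divisorTau (s - 1 / 2) (m / p)) else 0)) := by
  set A : ℝ → ℂ := fun y => (y : ℂ) ^ s +
      2 * s * xiFun (2 * s - 1) / ((2 * s - 2) * xiFun (2 * s)) * (y : ℂ) ^ (1 - s) with hA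
  have key := isEisCoeff_of_eq (𝔞 := 𝔞) (𝔟 := 𝔟) (s := s) hm hp.pos
    (fun y => ((p : ℂ) ^ s * A y - A (p * y)) / ((p : ℂ) ^ (2 * s) - 1))
    ((p : ℂ) ^ s * zetaFactor s / ((p : ℂ) ^ (2 * s) - 1)) (-zetaFactor s / ((p : ℂ) ^ (2 * s) - 1))
    (fun z => by
      rw [h, levelExt', eisExt, eisExt, hA]
      ring)
  convert key using 1
  split_ifs <;> ring

end EisFourier

/-! ### The coefficients at level one and at level `p` -/

open EisFourier in
theorem propositionp (p : ℕ) (hp : p.Prime) (m : ℤ) (hm : m ≠ 0)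
    (s : ℂ) (hs : s ≠ 1) (hps : (p : ℂ) ^ (2 * s) ≠ 1)
    (hζ : completedRiemannZeta (2 * s) ≠ 0) :
    -- the numbers `φ(s;m)` and `φ_{𝔞,𝔟}(s;m)` exist
    (IsEisCoeff cuspFull cuspFull s m (eisCoeff cuspFull cuspFull s m) ∧
      ∀ 𝔞 ∈ ({cuspInfty p, cuspZero p hp.pos} : Set (ScaledCusp (CongruenceSubgroup.Gamma0 p))),
      ∀ 𝔟 ∈ ({cuspInfty p, cuspZero p hp.pos} : Set (ScaledCusp (CongruenceSubgroup.Gamma0 p))),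
        IsEisCoeff 𝔞 𝔟 s m (eisCoeff 𝔞 𝔟 s m)) ∧
    -- the explicit value of `φ(s;m)`, where `1 / ζ^*(2s)` vanishes at `s = 1/2`
    eisCoeff cuspFull cuspFull s m =
      (if s = 1 / 2 then 0 else divisorTau (s - 1 / 2) m / completedRiemannZeta (2 * s)) ∧
    -- the coefficients `φ_{∞,∞}` and `φ_{0,0}`
    eisCoeff (cuspInfty p) (cuspInfty p) s m = eisCoeff (cuspZero p hp.pos) (cuspZero p hp.pos) s m ∧
    eisCoeff (cuspInfty p) (cuspInfty p) s m =
      1 / ((p : ℂ) ^ (2 * s) - 1) *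
        (if (p : ℤ) ∣ m then
          (p : ℂ) ^ (s + 1 / 2) * eisCoeff cuspFull cuspFull s (m / p) -
            eisCoeff cuspFull cuspFull s m
        else -eisCoeff cuspFull cuspFull s m) ∧
    -- the coefficients `φ_{∞,0}` and `φ_{0,∞}`
    eisCoeff (cuspInfty p) (cuspZero p hp.pos) s m = eisCoeff (cuspZero p hp.pos) (cuspInfty p) s m ∧
    eisCoeff (cuspInfty p) (cuspZero p hp.pos) s m =
      1 / ((p : ℂ) ^ (2 * s) - 1) *
        (if (p : ℤ) ∣ m then
          (p : ℂ) ^ s * eisCoeff cuspFull cuspFull s m -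
            (Real.sqrt p : ℂ) * eisCoeff cuspFull cuspFull s (m / p)
        else (p : ℂ) ^ s * eisCoeff cuspFull cuspFull s m) := by
  -- At `s = 0` one would have `p^(2s) = 1`.
  have hs0 : s ≠ 0 := by
    rintro rfl
    simp at hps
  have hD : xiFun (2 * s) ≠ 0 := xiFun_ne_zero hs0 hζ
  have hfull : ∀ n : ℤ, n ≠ 0 → IsEisCoeff cuspFull cuspFull s n
      (zetaFactor s * divisorTau (s - 1 / 2) n) := fun n hn => isEisCoeff_full hn hs hD
  have h11 := isEisCoeff_of_eq_levelExt hp hm (s := s)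
    fun z => eisenstein_infty_infty hp z hs hD hps
  have h00 := isEisCoeff_of_eq_levelExt hp hm (s := s)
    fun z => eisenstein_zero_zero hp z hs hD hps
  have h10 := isEisCoeff_of_eq_levelExt' hp hm (s := s)
    fun z => eisenstein_infty_zero hp z hs hD hps
  have h01 := isEisCoeff_of_eq_levelExt' hp hm (s := s)
    fun z => eisenstein_zero_infty hp z hs hD hps
  have ediv : ∀ n : ℤ, n ≠ 0 → eisCoeff cuspFull cuspFull s n =
      zetaFactor s * divisorTau (s - 1 / 2) n := fun n hn => (hfull n hn).eisCoeff_eq hn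
  -- The level one formula is stated for nonzero indices, so `m/p` must be nonzero when the division
  -- is exact.
  have hdvd : (p : ℤ) ∣ m → m / p ≠ 0 := by
    rintro ⟨N, rfl⟩
    have hp0 : (p : ℤ) ≠ 0 := by exact_mod_cast hp.ne_zero
    rw [Int.mul_ediv_cancel_left _ hp0]
    exact right_ne_zero_of_mul hm
  refine ⟨⟨?_, ?_⟩, ?_, ?_, ?_, ?_, ?_⟩
  · rw [ediv m hm]
    exact hfull m hm
  · rintro 𝔞 (rfl | rfl) 𝔟 (rfl | rfl)
    · rw [h11.eisCoeff_eq hm]; exact h11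
    · rw [h10.eisCoeff_eq hm]; exact h10
    · rw [h01.eisCoeff_eq hm]; exact h01
    · rw [h00.eisCoeff_eq hm]; exact h00
  · rw [ediv m hm, zetaFactor_eq hs0]
    split_ifs <;> ring
  · rw [h11.eisCoeff_eq hm, h00.eisCoeff_eq hm]
  · rw [h11.eisCoeff_eq hm, ediv m hm]
    split_ifs with h
    · rw [ediv _ (hdvd h)]
    · ring
  · rw [h10.eisCoeff_eq hm, h01.eisCoeff_eq hm]
  · rw [h10.eisCoeff_eq hm, ediv m hm]
    split_ifs with h
    · rw [ediv _ (hdvd h)]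
    · ring
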